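/- A binary tree is either a leaf or a node with a left and a right subtree, each of which is a binary tree; the height of a leaf is $0$ and the height of a tree with subtrees $L,R$ is $1+\max\{\operatorname{h}(L),\operatorname{h}(R)\}$. A tree is balanced if $\operatorname{h}(R)-\operatorname{h}(L)\in\{-1,0,1\}$ at each of its nodes, where $L$ and $R$ are the left and right subtrees of the node. A right rotation replaces a subtree $(A\wedge B)\wedge C$ by $A\wedge(B\wedge C)$, and the Tamari order $\le_{\mathrm T}$ is the reflexive and transitive closure of right rotation. A balanced tree $T$ is minimal if every tree from which $T$ is obtained by one right rotation is unbalanced, and maximal if every tree obtained from $T$ by one right rotation is unbalanced. A maximal balanced binary tree interval is an interval $[T_0,T_1]$, $T_0\le_{\mathrm T}T_1$, of the Tamari order with $T_0$ a minimal and $T_1$ a maximal balanced tree. **Proposition.** (1) There is a unique formal power series $\mathcal S_{\mathrm{mbi}}(x,y,z,t)\in\mathbb Z[[x,y,z,t]]$ with constant term $0$ such that $$\mathcal S_{\mathrm{mbi}}(x,y,z,t)=x+\mathcal S_{\mathrm{mbi}}(x^2+2yt+yz,\;x,\;x^2+xy,\;yt+yz),$$ and $\mathcal S_{\mathrm{mbi}}(x,0,0,0)$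 is the generating series of maximal balanced binary tree intervals by number of leaves: for every $n\ge 0$ the coefficient of $x^n$ is the number of maximal balanced binary tree intervals whose trees have $n$ leaves. (2) Each maximal balanced binary tree interval, with the order $\le_{\mathrm T}$, is isomorphic as a poset to the hypercube of dimension $k$ (the subsets of a $k$-element set ordered by inclusion) for exactly one $k\ge 0$. There is a unique formal power series $\mathcal S_{\mathrm{mbi}}(x,y,z,t,\xi)$ in $x,y,z,t$ with coefficients in $\mathbb Z[\xi]$ and with constant term $0$ such that $$\mathcal S_{\mathrm{mbi}}(x,y,z,t,\xi)=x+\mathcal S_{\mathrm{mbi}}(x^2+2yt+yz\xi,\;x,\;x^2+xy,\;yt+yz\xi,\;\xi),$$ and for all $n,k\ge 0$ the coefficient of $x^n\xi^k$ in $\mathcal S_{\mathrm{mbi}}(x,0,0,0,\xi)$ is the number of maximal balanced binary tree intervals whose trees have $n$ leaves and which are isomorphic to the hypercube of dimension $k$. -/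

import Mathlib

/-! Binary trees are Mathlib's `BinaryTree Unit`: `nil` is the leaf and `node () L R` is the tree
with left subtree `L` and right subtree `R`; `height` and `numLeaves` are the usual statistics. -/

/-- A binary tree is balanced if each of its nodes, with left subtree `L` and right subtree `R`,
has imbalance `h(R) - h(L)` in `{-1, 0, 1}`. -/
def IsBalancedTree : BinaryTree Unit → Prop
  | .nil => True
  | .node _ L R =>
      ((R.height : ℤ) - (L.height : ℤ)) ∈ ({-1, 0, 1} : Set ℤ) ∧
        IsBalancedTree L ∧ IsBalancedTree R

/-- `TreeRotation T T'`: the tree `T'` is obtained from `T` by one right rotation, that is, by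
replacing a subtree `(A ∧ B) ∧ C` by `A ∧ (B ∧ C)`. -/
inductive TreeRotation : BinaryTree Unit → BinaryTree Unit → Prop
  | root (A B C : BinaryTree Unit) :
      TreeRotation (.node () (.node () A B) C) (.node () A (.node () B C))
  | left {L L' : BinaryTree Unit} (R : BinaryTree Unit) (h : TreeRotation L L') :
      TreeRotation (.node () L R) (.node () L' R)
  | right (L : BinaryTree Unit) {R R' : BinaryTree Unit} (h : TreeRotation R R') :
      TreeRotation (.node () L R) (.node () L R')

/-- The Tamari order: the reflexive and transitive closure of right rotation. -/
def TamariLE : BinaryTree Unit → BinaryTree Unit → Prop :=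
  Relation.ReflTransGen TreeRotation

/-- A balanced tree is minimal if every tree that rotates to it is unbalanced. -/
def IsMinimalBalanced (T : BinaryTree Unit) : Prop :=
  IsBalancedTree T ∧ ∀ T' : BinaryTree Unit, TreeRotation T' T → ¬ IsBalancedTree T'

/-- A balanced tree is maximal if every tree that it rotates to is unbalanced. -/
def IsMaximalBalanced (T : BinaryTree Unit) : Prop :=
  IsBalancedTree T ∧ ∀ T' : BinaryTree Unit, TreeRotation T T' → ¬ IsBalancedTree T'

/-- `(T₀, T₁)` are the end points of a maximal balanced binary tree interval `[T₀, T₁]`. -/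
def IsMaximalBalancedInterval (I : BinaryTree Unit × BinaryTree Unit) : Prop :=
  TamariLE I.1 I.2 ∧ IsMinimalBalanced I.1 ∧ IsMaximalBalanced I.2

/-- The elements of the Tamari interval `[T₀, T₁]`. -/
def TamariInterval (I : BinaryTree Unit × BinaryTree Unit) : Type :=
  {T : BinaryTree Unit // TamariLE I.1 T ∧ TamariLE T I.2}

/-- The interval `[T₀, T₁]`, with the Tamari order, is isomorphic as a poset to the hypercube of
dimension `k`: the subsets of a `k`-element set ordered by inclusion. -/
def IsHypercubeInterval (I : BinaryTree Unit × BinaryTree Unit) (k : ℕ) : Prop :=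
  Nonempty ((fun S T : TamariInterval I => TamariLE S.1 T.1) ≃r
    (fun a b : Finset (Fin k) => a ⊆ b))

/-- The maximal balanced binary tree intervals whose trees have `n` leaves. -/
def maximalBalancedIntervals (n : ℕ) : Set (BinaryTree Unit × BinaryTree Unit) :=
  {I | IsMaximalBalancedInterval I ∧ I.1.numLeaves = n ∧ I.2.numLeaves = n}

/-- There are finitely many of them, so that `Set.ncard` counts them. -/
theorem finite_maximalBalancedIntervals (n : ℕ) : (maximalBalancedIntervals n).Finite := by
  have hfin : {T : BinaryTree Unit | T.numLeaves = n}.Finite := by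
    refine (BinaryTree.treesOfNumNodesEq (n - 1)).finite_toSet.subset ?_
    intro T hT
    have h1 : T.numLeaves = n := hT
    rw [BinaryTree.numLeaves_eq_numNodes_succ] at h1
    simp only [Finset.mem_coe, BinaryTree.mem_treesOfNumNodesEq]
    omega
  exact (hfin.prod hfin).subset fun I hI => ⟨hI.2.1, hI.2.2⟩

/-- The generating series of the maximal balanced binary tree intervals by number of leaves. -/
noncomputable def maximalBalancedIntervalSeries : PowerSeries ℤ :=
  PowerSeries.mk fun n => ((maximalBalancedIntervals n).ncard : ℤ)

/-- The variables `x`, `y`, `z`, `t` are `X 0`, `X 1`, `X 2`, `X 3`. This is the substitution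
`x ↦ x² + 2yt + yzξ`, `y ↦ x`, `z ↦ x² + xy`, `t ↦ yt + yzξ`, where `ξ` is a scalar. -/
noncomputable def mbiSubs {R : Type} [CommRing R] (ξ : R) : Fin 4 → MvPowerSeries (Fin 4) R :=
  let x : MvPowerSeries (Fin 4) R := MvPowerSeries.X 0
  let y : MvPowerSeries (Fin 4) R := MvPowerSeries.X 1
  let z : MvPowerSeries (Fin 4) R := MvPowerSeries.X 2
  let t : MvPowerSeries (Fin 4) R := MvPowerSeries.X 3
  ![x ^ 2 + 2 * y * t + y * z * MvPowerSeries.C ξ,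
    x,
    x ^ 2 + x * y,
    y * t + y * z * MvPowerSeries.C ξ]

/-- The substitution is a legitimate one: all its series have constant term `0`. -/
theorem hasSubst_mbiSubs {R : Type} [CommRing R] (ξ : R) :
    MvPowerSeries.HasSubst (mbiSubs ξ) := by
  refine MvPowerSeries.hasSubst_of_constantCoeff_zero fun i => ?_
  fin_cases i <;> simp [mbiSubs]

/-- `S` has constant term `0` and satisfies
`S(x, y, z, t) = x + S(x² + 2yt + yzξ, x, x² + xy, yt + yzξ)`. -/
def IsMbiSolution {R : Type} [CommRing R] (ξ : R) (S : MvPowerSeries (Fin 4) R) : Prop :=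
  MvPowerSeries.constantCoeff S = 0 ∧
    S = MvPowerSeries.X 0 + MvPowerSeries.subst (mbiSubs ξ) S

/-- The specialization point `(x, 0, 0, 0)`, with values in series in the single variable `x`. -/
noncomputable def mbiPoint (R : Type) [CommRing R] : Fin 4 → MvPowerSeries Unit R :=
  ![(PowerSeries.X : PowerSeries R), 0, 0, 0]

/-- The specialization is legitimate. -/
theorem hasSubst_mbiPoint (R : Type) [CommRing R] : MvPowerSeries.HasSubst (mbiPoint R) := by
  refine MvPowerSeries.hasSubst_of_constantCoeff_zero fun i => ?_
  fin_cases i <;> simp [mbiPoint, PowerSeries.X]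

/-- The series `S(x, 0, 0, 0)`. -/
noncomputable def mbiSpecialize {R : Type} [CommRing R] (S : MvPowerSeries (Fin 4) R) :
    PowerSeries R :=
  MvPowerSeries.subst (mbiPoint R) S

/-! Write h for the height. A rotation of (A∧B)∧C inside a balanced tree gives a balanced tree
exactly when h(A) = h(C) ≥ h(B), and it then preserves the height of the subtree. Otherwise the
right side of the new node A∧(B∧C) overhangs A by at least 2, and `HasOverhang` records this in a
form that no later rotation can repair. Hence the trees between two balanced trees are all balanced,
and every such interval is built from leaves by two moves: put two intervals under a common root, or
take three intervals A, B, C and let the root rotate as well (`IsBalancedInterval`). Each root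
rotation is an independent binary choice, so k of them give a hypercube of dimension k.

Minimality of the lower end and maximality of the upper end are conditions at each node on heights
and on the imbalance of one child. So the maximal intervals of height h+1 are determined by four
families: those of height h (x), those of height h-1 (y), the pairs with heights (h-1, h-1) or (h-1,
h-2) (z), and those of height h whose lower end has imbalance -1 (t). The intervals of height h
whose upper end has imbalance 1 have the same series as t. The recursion from h to h+1 is the
substitution of the functional equation, each root rotation contributing ξ, and h = 0 is the point
(x,0,0,0).

Finally, the substitution raises a suitable weighted order. This gives existence and uniqueness of
the solution S, and iterating the equation at (x,0,0,0) writes S(x,0,0,0) as the sum over all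
heights of the first coordinate of the orbit. -/

namespace BalancedTamari

/-! ### Prefixes of trees -/

/-- `TreePrefix P T`: the tree `P` is obtained from `T` by keeping only an initial segment of its
leaves and contracting the nodes with a single child. -/
inductive TreePrefix : BinaryTree Unit → BinaryTree Unit → Prop
  | nil : TreePrefix .nil .nil
  | left {P L : BinaryTree Unit} (R : BinaryTree Unit) (h : TreePrefix P L) :
      TreePrefix P (.node () L R)
  | right (L : BinaryTree Unit) {P R : BinaryTree Unit} (h : TreePrefix P R) :
      TreePrefix (.node () L P) (.node () L R)

theorem TreePrefix.refl : ∀ T : BinaryTree Unit, TreePrefix T T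
  | .nil => .nil
  | .node _ L R => .right L (TreePrefix.refl R)

theorem TreePrefix.trans {P Q T : BinaryTree Unit} (h : TreePrefix P Q) (h' : TreePrefix Q T) :
    TreePrefix P T := by
  induction h' generalizing P with
  | nil => exact h
  | left R _ ih => exact .left R (ih h)
  | right L _ ih =>
    cases h with
    | left _ h => exact .left _ h
    | right _ h => exact .right _ (ih h)

theorem TreePrefix.height_le {P T : BinaryTree Unit} (h : TreePrefix P T) :
    P.height ≤ T.height := by
  induction h with
  | nil => exact le_rfl
  | left R _ ih => simp only [BinaryTree.height]; omega
  | right L _ ih => simp only [BinaryTree.height]; omega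

/-- Restriction to an initial segment of the leaves is compatible with right rotations. -/
theorem TreePrefix.rotation {P T T' : BinaryTree Unit} (hr : TreeRotation T T')
    (h : TreePrefix P T) :
    TreePrefix P T' ∨ ∃ P', TreeRotation P P' ∧ TreePrefix P' T' := by
  induction hr generalizing P with
  | root A B C =>
    cases h with
    | left _ h =>
      cases h with
      | left _ h => exact .inl (.left _ h)
      | right _ h => exact .inl (.right _ (.left _ h))
    | right _ h => exact .inr ⟨_, .root _ _ _, .right _ (.right _ h)⟩
  | left R hr ih =>
    cases h with
    | left _ h =>
      rcases ih h with h | ⟨P', h₁, h₂⟩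
      · exact .inl (.left _ h)
      · exact .inr ⟨P', h₁, .left _ h₂⟩
    | right _ h => exact .inr ⟨_, .left _ hr, .right _ h⟩
  | right L hr ih =>
    cases h with
    | left _ h => exact .inl (.left _ h)
    | right _ h =>
      rcases ih h with h | ⟨P', h₁, h₂⟩
      · exact .inl (.right _ h)
      · exact .inr ⟨_, .right _ h₁, .right _ h₂⟩

/-! ### Overhangs: unbalancedness that rotations cannot repair -/

/-- Every node has imbalance at least `-1`. -/
def ImbalanceGeNegOne : BinaryTree Unit → Prop
  | .nil => True
  | .node _ L R => L.height ≤ R.height + 1 ∧ ImbalanceGeNegOne L ∧ ImbalanceGeNegOne R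

theorem isBalancedTree_node {L R : BinaryTree Unit} :
    IsBalancedTree (.node () L R) ↔
      (L.height ≤ R.height + 1 ∧ R.height ≤ L.height + 1) ∧
        IsBalancedTree L ∧ IsBalancedTree R := by
  have h : ((R.height : ℤ) - (L.height : ℤ)) ∈ ({-1, 0, 1} : Set ℤ) ↔
      (L.height ≤ R.height + 1 ∧ R.height ≤ L.height + 1) := by
    simp only [Set.mem_insert_iff, Set.mem_singleton_iff]
    omega
  rw [IsBalancedTree, h]

theorem imbalanceGeNegOne_of_isBalancedTree :
    ∀ {T : BinaryTree Unit}, IsBalancedTree T → ImbalanceGeNegOne T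
  | .nil, _ => trivial
  | .node _ _ _, h =>
    have h := isBalancedTree_node.1 h
    ⟨h.1.1, imbalanceGeNegOne_of_isBalancedTree h.2.1,
      imbalanceGeNegOne_of_isBalancedTree h.2.2⟩

/-- A certificate of unbalancedness that right rotations preserve: at some node, with left subtree
`A` and right subtree `E`, a prefix of `E` is higher than `A` by at least `2`, where both this
prefix and `A` have imbalances at least `-1`. -/
inductive HasOverhang : BinaryTree Unit → Prop
  | root {A E P : BinaryTree Unit} (hA : ImbalanceGeNegOne A) (hP : ImbalanceGeNegOne P)
      (h : TreePrefix P E) (hh : A.height + 2 ≤ P.height) : HasOverhang (.node () A E)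
  | left {L : BinaryTree Unit} (R : BinaryTree Unit) (h : HasOverhang L) :
      HasOverhang (.node () L R)
  | right (L : BinaryTree Unit) {R : BinaryTree Unit} (h : HasOverhang R) :
      HasOverhang (.node () L R)

theorem HasOverhang.not_isBalancedTree {T : BinaryTree Unit} (h : HasOverhang T) :
    ¬ IsBalancedTree T := by
  induction h with
  | root _ _ h hh =>
    intro hb
    have := (isBalancedTree_node.1 hb).1
    have := h.height_le
    omega
  | left R _ ih => exact fun hb => ih (isBalancedTree_node.1 hb).2.1
  | right L _ ih => exact fun hb => ih (isBalancedTree_node.1 hb).2.2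

/-- A prefix keeps the whole left subtree of any node whose right subtree it cuts, and a prefix of a
prefix is a prefix. -/
theorem HasOverhang.of_prefix {P T : BinaryTree Unit} (h : TreePrefix P T) (hP : HasOverhang P) :
    HasOverhang T := by
  induction h with
  | nil => exact hP
  | left R _ ih => exact .left _ (ih hP)
  | right L h ih =>
    cases hP with
    | root hA hQ hQP hh => exact .root hA hQ (hQP.trans h) hh
    | left _ h => exact .left _ h
    | right _ h => exact .right _ (ih h)

/-- A rotation in a tree with imbalances at least `-1` either produces an overhang, or preserves
the height, this property, and being balanced. -/
theorem ImbalanceGeNegOne.rotation {T T' : BinaryTree Unit} (hr : TreeRotation T T')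
    (hT : ImbalanceGeNegOne T) :
    HasOverhang T' ∨ (ImbalanceGeNegOne T' ∧ T'.height = T.height ∧
      (IsBalancedTree T → IsBalancedTree T')) := by
  induction hr with
  | root A B C =>
    obtain ⟨h₁, ⟨h₂, hA, hB⟩, hC⟩ := hT
    simp only [BinaryTree.height] at h₁
    have hBC : ImbalanceGeNegOne (.node () B C) := ⟨by omega, hB, hC⟩
    by_cases h : A.height + 2 ≤ (BinaryTree.node () B C).height
    · exact .inl (.root hA hBC (.refl _) h)
    -- Without an overhang the inequalities force h(A) = h(C) ≥ h(B), so both trees have height h(A)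
    -- + 2.
    · refine .inr ⟨⟨?_, hA, hBC⟩, ?_, ?_⟩
      · simp only [BinaryTree.height] at h ⊢; omega
      · simp only [BinaryTree.height] at h ⊢; omega
      · simp only [isBalancedTree_node, BinaryTree.height] at h ⊢
        rintro ⟨_, ⟨_, hA, hB⟩, hC⟩
        refine ⟨by omega, hA, by omega, hB, hC⟩
  | left R hr ih =>
    obtain ⟨h₁, hL, hR⟩ := hT
    rcases ih hL with h | ⟨h, hh, hb⟩
    · exact .inl (.left _ h)
    · refine .inr ⟨⟨by omega, h, hR⟩, by simp only [BinaryTree.height, hh], ?_⟩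
      simp only [isBalancedTree_node, hh]
      exact fun h => ⟨h.1, hb h.2.1, h.2.2⟩
  | right L hr ih =>
    obtain ⟨h₁, hL, hR⟩ := hT
    rcases ih hR with h | ⟨h, hh, hb⟩
    · exact .inl (.right _ h)
    · refine .inr ⟨⟨by omega, hL, h⟩, by simp only [BinaryTree.height, hh], ?_⟩
      simp only [isBalancedTree_node, hh]
      exact fun h => ⟨h.1, h.2.1, hb h.2.2⟩

/-- A rotation inside `A` or inside the prefix either creates a new overhang or preserves the
height, so the inequality survives. A rotation at the node itself only adds to what lies to the
right of the new left subtree. -/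
theorem HasOverhang.rotation {T T' : BinaryTree Unit} (hr : TreeRotation T T')
    (hT : HasOverhang T) : HasOverhang T' := by
  induction hr with
  | root A B C =>
    cases hT with
    | @root _ _ P hA hP h hh =>
      obtain ⟨h₁, hA, hB⟩ := hA
      simp only [BinaryTree.height] at hh
      refine .root hA (P := .node () B P) ⟨by omega, hB, hP⟩ (.right _ h) ?_
      simp only [BinaryTree.height]
      omega
    | left _ h =>
      cases h with
      -- The right subtree grows from B to B∧C, which may have an imbalance below -1 at its root;
      -- the prefix of B is still a prefix of it.
      | root hA hP h hh => exact .root hA hP (.left _ h) hh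
      | left _ h => exact .left _ h
      | right _ h => exact .right _ (.left _ h)
    | right _ h => exact .right _ (.right _ h)
  | left R hr ih =>
    cases hT with
    | root hA hP h hh =>
      rcases hA.rotation hr with h' | ⟨h', hh', _⟩
      · exact .left _ h'
      · exact .root h' hP h (by omega)
    | left _ h => exact .left _ (ih h)
    | right _ h => exact .right _ h
  | right L hr ih =>
    cases hT with
    | root hA hP h hh =>
      rcases h.rotation hr with h' | ⟨P', hr', h'⟩
      · exact .root hA hP h' hh
      · rcases hP.rotation hr' with ho | ⟨hP', hh', _⟩
        · exact .right _ (ho.of_prefix h')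
        · exact .root hA hP' h' (by omega)
    | left _ h => exact .left _ h
    | right _ h => exact .right _ (ih h)

theorem HasOverhang.of_tamariLE {T T' : BinaryTree Unit} (h : TamariLE T T')
    (hT : HasOverhang T) : HasOverhang T' := by
  induction h with
  | refl => exact hT
  | tail _ hr ih => exact ih.rotation hr

/-! ### Intervals between balanced trees -/

/-- `IsBalancedInterval T₀ T₁ k`: the balanced tree `T₁` is obtained from the balanced tree `T₀`
by `k` rotations between balanced trees, no two of them involving the same node. -/
inductive IsBalancedInterval : BinaryTree Unit → BinaryTree Unit → ℕ → Prop
  | nil : IsBalancedInterval .nil .nil 0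
  | node {L₀ L₁ R₀ R₁ : BinaryTree Unit} {a b : ℕ} (h : L₀.height ≤ R₀.height + 1)
      (h' : R₀.height ≤ L₀.height + 1) (hL : IsBalancedInterval L₀ L₁ a)
      (hR : IsBalancedInterval R₀ R₁ b) :
      IsBalancedInterval (.node () L₀ R₀) (.node () L₁ R₁) (a + b)
  | rot {A₀ A₁ B₀ B₁ C₀ C₁ : BinaryTree Unit} {a b c : ℕ} (h : A₀.height = C₀.height)
      (h' : B₀.height ≤ A₀.height) (h'' : A₀.height ≤ B₀.height + 1)
      (hA : IsBalancedInterval A₀ A₁ a) (hB : IsBalancedInterval B₀ B₁ b)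
      (hC : IsBalancedInterval C₀ C₁ c) :
      IsBalancedInterval (.node () (.node () A₀ B₀) C₀) (.node () A₁ (.node () B₁ C₁))
        (a + b + c + 1)

namespace IsBalancedInterval

variable {T₀ T₁ : BinaryTree Unit} {k : ℕ}

theorem height_eq (h : IsBalancedInterval T₀ T₁ k) : T₁.height = T₀.height := by
  induction h with
  | nil => rfl
  | node _ _ _ _ ihL ihR => simp only [BinaryTree.height, ihL, ihR]
  | rot => simp only [BinaryTree.height]; omega

theorem numLeaves_eq (h : IsBalancedInterval T₀ T₁ k) : T₁.numLeaves = T₀.numLeaves := by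
  induction h with
  | nil => rfl
  | node _ _ _ _ ihL ihR => simp only [BinaryTree.numLeaves, ihL, ihR]
  | rot => simp only [BinaryTree.numLeaves]; omega

theorem isBalancedTree_left (h : IsBalancedInterval T₀ T₁ k) : IsBalancedTree T₀ := by
  induction h with
  | nil => trivial
  | node h h' _ _ ihL ihR => exact isBalancedTree_node.2 ⟨⟨h, h'⟩, ihL, ihR⟩
  | rot h h' h'' _ _ _ ihA ihB ihC =>
    simp only [isBalancedTree_node, BinaryTree.height]
    exact ⟨by omega, ⟨by omega, ihA, ihB⟩, ihC⟩

theorem isBalancedTree_right (h : IsBalancedInterval T₀ T₁ k) : IsBalancedTree T₁ := by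
  induction h with
  | nil => trivial
  | node h h' hL hR ihL ihR =>
    exact isBalancedTree_node.2 ⟨by rw [hL.height_eq, hR.height_eq]; exact ⟨h, h'⟩, ihL, ihR⟩
  | rot h h' h'' hA hB hC ihA ihB ihC =>
    simp only [isBalancedTree_node, BinaryTree.height, hA.height_eq, hB.height_eq, hC.height_eq]
    exact ⟨by omega, ihA, by omega, ihB, ihC⟩

end IsBalancedInterval

theorem tamariLE_node {L L' R R' : BinaryTree Unit} (hL : TamariLE L L') (hR : TamariLE R R') :
    TamariLE (.node () L R) (.node () L' R') :=
  (Relation.ReflTransGen.lift (fun T => BinaryTree.node () T R) (fun _ _ h => .left R h)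
    _ _ hL).trans
    (Relation.ReflTransGen.lift (fun T => BinaryTree.node () L' T) (fun _ _ h => .right L' h)
      _ _ hR)

theorem IsBalancedInterval.tamariLE {T₀ T₁ : BinaryTree Unit} {k : ℕ}
    (h : IsBalancedInterval T₀ T₁ k) : TamariLE T₀ T₁ := by
  induction h with
  | nil => exact .refl
  | node _ _ _ _ ihL ihR => exact tamariLE_node ihL ihR
  | rot _ _ _ _ _ _ ihA ihB ihC =>
    exact (tamariLE_node (tamariLE_node ihA ihB) ihC).tail (.root _ _ _)

theorem IsBalancedInterval.refl :
    ∀ {T : BinaryTree Unit}, IsBalancedTree T → IsBalancedInterval T T 0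
  | .nil, _ => .nil
  | .node _ _ _, h =>
    have h := isBalancedTree_node.1 h
    .node h.1.1 h.1.2 (IsBalancedInterval.refl h.2.1) (IsBalancedInterval.refl h.2.2)

/-- A rotation between balanced trees extends a balanced interval. -/
theorem IsBalancedInterval.tail {T₀ T T' : BinaryTree Unit} {k : ℕ}
    (h : IsBalancedInterval T₀ T k) (hr : TreeRotation T T') (hb : IsBalancedTree T') :
    IsBalancedInterval T₀ T' (k + 1) := by
  induction h generalizing T' with
  | nil => cases hr
  | @node L₀ L₁ R₀ R₁ a b h h' hL hR ihL ihR =>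
    cases hr with
    | root A B C =>
      simp only [isBalancedTree_node, BinaryTree.height] at hb
      have eL := hL.height_eq
      have eR := hR.height_eq
      cases hL with
      | node h₁ h₂ hA hB =>
        have eA := hA.height_eq
        have eB := hB.height_eq
        simp only [BinaryTree.height] at *
        exact .rot (by omega) (by omega) (by omega) hA hB hR
      -- The left subtree has already been rotated and has imbalance 1; rotating it at the root
      -- would leave a right side at least 2 higher than its left subtree.
      | rot h₁ h₂ h₃ hA hB hC =>
        have eA := hA.height_eq
        have eC := hC.height_eq
        simp only [BinaryTree.height] at *
        omega
    | left _ hr =>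
      have := IsBalancedInterval.node h h' (ihL hr (isBalancedTree_node.1 hb).2.1) hR
      rwa [show a + b + 1 = a + 1 + b by omega]
    | right _ hr =>
      have := IsBalancedInterval.node h h' hL (ihR hr (isBalancedTree_node.1 hb).2.2)
      rwa [← add_assoc] at this
  | @rot A₀ A₁ B₀ B₁ C₀ C₁ a b c h h' h'' hA hB hC ihA ihB ihC =>
    have eA := hA.height_eq
    have eB := hB.height_eq
    have eC := hC.height_eq
    cases hr with
    -- A second rotation at the root gives P∧(Q∧(B∧C)) with h(P) < h(A) = h(C), which is unbalanced.
    | root P Q _ =>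
      simp only [isBalancedTree_node, BinaryTree.height] at hb eA
      omega
    | left _ hr =>
      have := IsBalancedInterval.rot h h' h'' (ihA hr (isBalancedTree_node.1 hb).2.1) hB hC
      rwa [show a + b + c + 1 + 1 = a + 1 + b + c + 1 by omega]
    | right _ hr =>
      have hb := (isBalancedTree_node.1 hb).2.2
      cases hr with
      -- Here the right subtree would become P∧(Q∧C) with h(P) < h(B) ≤ h(C), again unbalanced.
      | root P Q _ =>
        simp only [isBalancedTree_node, BinaryTree.height] at hb eB
        omega
      | left _ hr =>
        have := IsBalancedInterval.rot h h' h'' hA (ihB hr (isBalancedTree_node.1 hb).2.1) hC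
        rwa [show a + b + c + 1 + 1 = a + (b + 1) + c + 1 by omega]
      | right _ hr =>
        have := IsBalancedInterval.rot h h' h'' hA hB (ihC hr (isBalancedTree_node.1 hb).2.2)
        rwa [← add_assoc] at this

/-- Along a chain of rotations, each step between balanced trees extends the interval; the first
step that leaves the balanced trees creates an overhang, which then persists. -/
theorem exists_isBalancedInterval_or_hasOverhang {T₀ T : BinaryTree Unit}
    (h₀ : IsBalancedTree T₀) (h : TamariLE T₀ T) :
    (∃ k, IsBalancedInterval T₀ T k) ∨ HasOverhang T := by
  induction h with
  | refl => exact .inl ⟨0, .refl h₀⟩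
  | tail _ hr ih =>
    rcases ih with ⟨k, hk⟩ | h
    · have hb := hk.isBalancedTree_right
      rcases (imbalanceGeNegOne_of_isBalancedTree hb).rotation hr with h | ⟨_, _, h⟩
      · exact .inr h
      · exact .inl ⟨_, hk.tail hr (h hb)⟩
    · exact .inr (h.rotation hr)

/-- Between balanced trees, all the trees of a Tamari interval are balanced. -/
theorem isBalancedTree_of_tamariLE {T₀ T T₁ : BinaryTree Unit} (h₀ : IsBalancedTree T₀)
    (h₁ : IsBalancedTree T₁) (h : TamariLE T₀ T) (h' : TamariLE T T₁) : IsBalancedTree T := by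
  rcases exists_isBalancedInterval_or_hasOverhang h₀ h with ⟨k, hk⟩ | ho
  · exact hk.isBalancedTree_right
  · exact absurd h₁ (ho.of_tamariLE h').not_isBalancedTree

theorem exists_isBalancedInterval_iff {T₀ T₁ : BinaryTree Unit} :
    (∃ k, IsBalancedInterval T₀ T₁ k) ↔
      IsBalancedTree T₀ ∧ IsBalancedTree T₁ ∧ TamariLE T₀ T₁ := by
  constructor
  · rintro ⟨k, h⟩
    exact ⟨h.isBalancedTree_left, h.isBalancedTree_right, h.tamariLE⟩
  · rintro ⟨h₀, h₁, h⟩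
    exact (exists_isBalancedInterval_or_hasOverhang h₀ h).resolve_right
      fun ho => ho.not_isBalancedTree h₁

/-! ### Hypercubes -/

/-- The Tamari order between balanced trees. -/
def BalancedLE (S T : BinaryTree Unit) : Prop := ∃ k, IsBalancedInterval S T k

namespace BalancedLE

variable {S T L L' R R' A A' B B' C C' : BinaryTree Unit}

theorem height_eq (h : BalancedLE S T) : T.height = S.height := h.choose_spec.height_eq

theorem node (h : L.height ≤ R.height + 1) (h' : R.height ≤ L.height + 1)
    (hL : BalancedLE L L') (hR : BalancedLE R R') :
    BalancedLE (.node () L R) (.node () L' R') := by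
  obtain ⟨a, hL⟩ := hL
  obtain ⟨b, hR⟩ := hR
  exact ⟨_, .node h h' hL hR⟩

theorem rot (h : A.height = C.height) (h' : B.height ≤ A.height) (h'' : A.height ≤ B.height + 1)
    (hA : BalancedLE A A') (hB : BalancedLE B B') (hC : BalancedLE C C') :
    BalancedLE (.node () (.node () A B) C) (.node () A' (.node () B' C')) := by
  obtain ⟨a, hA⟩ := hA
  obtain ⟨b, hB⟩ := hB
  obtain ⟨c, hC⟩ := hC
  exact ⟨_, .rot h h' h'' hA hB hC⟩

theorem node_left_cases (h : BalancedLE (.node () L R) T) :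
    (∃ L' R', T = .node () L' R' ∧ BalancedLE L L' ∧ BalancedLE R R') ∨
      ∃ A B A' B' C', L = .node () A B ∧ T = .node () A' (.node () B' C') ∧
        A.height = R.height ∧ B.height ≤ A.height ∧
        BalancedLE A A' ∧ BalancedLE B B' ∧ BalancedLE R C' := by
  obtain ⟨k, h⟩ := h
  cases h with
  | node h h' hL hR => exact .inl ⟨_, _, rfl, ⟨_, hL⟩, ⟨_, hR⟩⟩
  | rot h h' h'' hA hB hC =>
    exact .inr ⟨_, _, _, _, _, rfl, rfl, h, h', ⟨_, hA⟩, ⟨_, hB⟩, ⟨_, hC⟩⟩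

/-- A rotation at the root lowers the left subtree by one, and nothing else changes its height.
Comparing the heights of left subtrees thus tells whether the root was rotated. -/
theorem node_of_height_eq (h : BalancedLE (.node () L R) (.node () L' R'))
    (hh : L'.height = L.height) : BalancedLE L L' ∧ BalancedLE R R' := by
  obtain ⟨k, h⟩ := h
  cases h with
  | node h h' hL hR => exact ⟨⟨_, hL⟩, ⟨_, hR⟩⟩
  | rot h h' h'' hA hB hC =>
    have eA := hA.height_eq
    simp only [BinaryTree.height] at hh
    omega

theorem rot_of_height_lt
    (h : BalancedLE (.node () (.node () A B) C) (.node () A' (.node () B' C')))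
    (hh : A'.height ≤ A.height) : BalancedLE A A' ∧ BalancedLE B B' ∧ BalancedLE C C' := by
  obtain ⟨k, h⟩ := h
  cases h with
  | node h h' hL hR =>
    have eL := hL.height_eq
    simp only [BinaryTree.height] at eL
    omega
  | rot h h' h'' hA hB hC => exact ⟨⟨_, hA⟩, ⟨_, hB⟩, ⟨_, hC⟩⟩

theorem height_left_le (h : BalancedLE (.node () L R) (.node () L' R')) :
    L'.height ≤ L.height := by
  obtain ⟨k, h⟩ := h
  cases h with
  | node h h' hL hR => exact hL.height_eq.le
  | rot h h' h'' hA hB hC =>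
    have eA := hA.height_eq
    simp only [BinaryTree.height]
    omega

end BalancedLE

/-- A balanced interval of dimension `k` is the image of a hypercube of dimension `k`. -/
theorem IsBalancedInterval.exists_hypercube {T₀ T₁ : BinaryTree Unit} {k : ℕ}
    (h : IsBalancedInterval T₀ T₁ k) :
    ∃ (ι : Type) (_ : Fintype ι) (f : (ι → Prop) → BinaryTree Unit), Fintype.card ι = k ∧
      (∀ a b, BalancedLE (f a) (f b) ↔ a ≤ b) ∧
      ∀ T, (BalancedLE T₀ T ∧ BalancedLE T T₁) ↔ ∃ a, f a = T := by
  induction h with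
  | nil =>
    refine ⟨Empty, inferInstance, fun _ => .nil, rfl, fun a b => ?_, fun T => ?_⟩
    · exact iff_of_true ⟨0, .nil⟩ fun i => i.elim
    · constructor
      · rintro ⟨⟨_, h⟩, _⟩
        cases h
        exact ⟨fun i => i.elim, rfl⟩
      · rintro ⟨_, rfl⟩
        exact ⟨⟨0, .nil⟩, ⟨0, .nil⟩⟩
  | @node L₀ L₁ R₀ R₁ _ _ h h' hL hR ihL ihR =>
    obtain ⟨ι, _, f, rfl, hf, hf'⟩ := ihL
    obtain ⟨κ, _, g, rfl, hg, hg'⟩ := ihR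
    have ef : ∀ a, (f a).height = L₀.height := fun a => ((hf' _).2 ⟨a, rfl⟩).1.height_eq
    have eg : ∀ a, (g a).height = R₀.height := fun a => ((hg' _).2 ⟨a, rfl⟩).1.height_eq
    have eL := hL.height_eq
    refine ⟨ι ⊕ κ, inferInstance,
      fun a => .node () (f fun i => a (.inl i)) (g fun i => a (.inr i)), Fintype.card_sum,
      fun a b => ?_, fun T => ⟨?_, ?_⟩⟩
    · constructor
      · intro h
        obtain ⟨h₁, h₂⟩ := h.node_of_height_eq (by rw [ef, ef])
        rw [hf] at h₁
        rw [hg] at h₂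
        exact Sum.rec h₁ h₂
      · intro hab
        refine .node (by rw [ef, eg]; exact h) (by rw [ef, eg]; exact h')
          ((hf _ _).2 fun i => hab _) ((hg _ _).2 fun i => hab _)
    · rintro ⟨h₁, h₂⟩
      rcases h₁.node_left_cases with
        ⟨L, R, rfl, hL', hR'⟩ | ⟨A, B, A', B', C', rfl, rfl, hA, hB, hA', -, -⟩
      · obtain ⟨h₃, h₄⟩ := h₂.node_of_height_eq (by rw [eL, hL'.height_eq])
        obtain ⟨a, rfl⟩ := (hf' L).1 ⟨hL', h₃⟩
        obtain ⟨b, rfl⟩ := (hg' R).1 ⟨hR', h₄⟩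
        exact ⟨Sum.elim a b, rfl⟩
      -- A root rotation would lower the left subtree below the height of `L₁`, and the order never
      -- raises it again.
      · have := h₂.height_left_le
        have := hA'.height_eq
        simp only [BinaryTree.height] at *
        omega
    · rintro ⟨a, rfl⟩
      obtain ⟨h₁, h₂⟩ := (hf' _).2 ⟨fun i => a (.inl i), rfl⟩
      obtain ⟨h₃, h₄⟩ := (hg' _).2 ⟨fun i => a (.inr i), rfl⟩
      exact ⟨.node h h' h₁ h₃, .node (by rw [ef, eg]; exact h) (by rw [ef, eg]; exact h') h₂ h₄⟩
  | @rot A₀ A₁ B₀ B₁ C₀ C₁ _ _ _ h h' h'' hA hB hC ihA ihB ihC =>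
    obtain ⟨ι, _, f, rfl, hf, hf'⟩ := ihA
    obtain ⟨κ, _, g, rfl, hg, hg'⟩ := ihB
    obtain ⟨μ, _, e, rfl, he, he'⟩ := ihC
    have ef : ∀ a, (f a).height = A₀.height := fun a => ((hf' _).2 ⟨a, rfl⟩).1.height_eq
    have eg : ∀ a, (g a).height = B₀.height := fun a => ((hg' _).2 ⟨a, rfl⟩).1.height_eq
    have ee : ∀ a, (e a).height = C₀.height := fun a => ((he' _).2 ⟨a, rfl⟩).1.height_eq
    have eA := hA.height_eq
    have eB := hB.height_eq
    have eC := hC.height_eq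
    classical
    -- The extra coordinate in `Unit` records whether the root has been rotated.
    set F : (((ι ⊕ κ) ⊕ μ) ⊕ Unit → Prop) → BinaryTree Unit := fun a =>
      if a (.inr ()) then
        .node () (f fun i => a (.inl (.inl (.inl i))))
          (.node () (g fun i => a (.inl (.inl (.inr i)))) (e fun i => a (.inl (.inr i))))
      else
        .node () (.node () (f fun i => a (.inl (.inl (.inl i))))
          (g fun i => a (.inl (.inl (.inr i))))) (e fun i => a (.inl (.inr i))) with hF
    have hle : ∀ a b : ((ι ⊕ κ) ⊕ μ) ⊕ Unit → Prop, a ≤ b ↔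
        ((fun i => a (.inl (.inl (.inl i)))) ≤ fun i => b (.inl (.inl (.inl i)))) ∧
        ((fun i => a (.inl (.inl (.inr i)))) ≤ fun i => b (.inl (.inl (.inr i)))) ∧
        ((fun i => a (.inl (.inr i))) ≤ fun i => b (.inl (.inr i))) ∧
        (a (.inr ()) → b (.inr ())) := by
      intro a b
      constructor
      · exact fun h => ⟨fun i => h _, fun i => h _, fun i => h _, h _⟩
      · rintro ⟨h₁, h₂, h₃, h₄⟩ (((i | i) | i) | i)
        exacts [h₁ i, h₂ i, h₃ i, h₄]
    refine ⟨((ι ⊕ κ) ⊕ μ) ⊕ Unit, inferInstance, F, by simp, fun a b => ?_, fun T => ⟨?_, ?_⟩⟩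
    · rw [hle, ← hf, ← hg, ← he]
      simp only [hF]
      by_cases ha : a (.inr ()) <;> by_cases hb : b (.inr ()) <;>
        simp only [ha, hb, if_true, if_false, forall_const, and_true, and_false, iff_false,
          false_imp_iff]
      · constructor
        · intro h
          obtain ⟨h₁, h₂⟩ := h.node_of_height_eq (by rw [ef, ef])
          exact ⟨h₁, h₂.node_of_height_eq (by rw [eg, eg])⟩
        · rintro ⟨h₁, h₂, h₃⟩
          refine .node ?_ ?_ h₁ (.node ?_ ?_ h₂ h₃) <;>
            simp only [BinaryTree.height, ef, eg, ee] <;> omega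
      -- A tree rotated at the root is never below an unrotated one: the left subtree would have to
      -- become higher.
      · intro h
        have := h.height_left_le
        simp only [BinaryTree.height, ef, eg] at this
        omega
      · constructor
        · intro h
          exact h.rot_of_height_lt (by rw [ef, ef])
        · rintro ⟨h₁, h₂, h₃⟩
          refine .rot ?_ ?_ ?_ h₁ h₂ h₃ <;> simp only [ef, eg, ee] <;> omega
      · constructor
        · intro h
          obtain ⟨h₁, h₂⟩ := h.node_of_height_eq (by simp only [BinaryTree.height, ef, eg])
          have := h₁.node_of_height_eq (by rw [ef, ef])
          exact ⟨this.1, this.2, h₂⟩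
        · rintro ⟨h₁, h₂, h₃⟩
          refine .node ?_ ?_ (.node ?_ ?_ h₁ h₂) h₃ <;>
            simp only [BinaryTree.height, ef, eg, ee] <;> omega
    · rintro ⟨h₁, h₂⟩
      suffices H : ∃ A B C, (T = .node () (.node () A B) C ∨ T = .node () A (.node () B C)) ∧
          (BalancedLE A₀ A ∧ BalancedLE A A₁) ∧ (BalancedLE B₀ B ∧ BalancedLE B B₁) ∧
          (BalancedLE C₀ C ∧ BalancedLE C C₁) by
        obtain ⟨A, B, C, hT, hA', hB', hC'⟩ := H
        obtain ⟨a, rfl⟩ := (hf' A).1 hA'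
        obtain ⟨b, rfl⟩ := (hg' B).1 hB'
        obtain ⟨c, rfl⟩ := (he' C).1 hC'
        rcases hT with rfl | rfl
        · exact ⟨Sum.elim (Sum.elim (Sum.elim a b) c) fun _ => False, by simp [hF]⟩
        · exact ⟨Sum.elim (Sum.elim (Sum.elim a b) c) fun _ => True, by simp [hF]⟩
      rcases h₁.node_left_cases with
        ⟨L, R, rfl, hL', hR'⟩ | ⟨A, B, A', B', C', hL, rfl, -, -, hA', hB', hC'⟩
      · have eL := hL'.height_eq
        rcases h₂.node_left_cases with
          ⟨L', R', hT, hL₁, hR₁⟩ | ⟨A', B', A'', B'', C'', rfl, hT, h₃, h₄, hA₁, hB₁, hC₁⟩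
        · cases hT
          have := hL₁.height_eq
          simp only [BinaryTree.height] at *
          omega
        · cases hT
          obtain ⟨h₅, h₆⟩ := hL'.node_of_height_eq (by rw [← hA₁.height_eq, eA])
          exact ⟨A', B', R, .inl rfl, ⟨h₅, hA₁⟩, ⟨h₆, hB₁⟩, ⟨hR', hC₁⟩⟩
      · cases hL
        obtain ⟨h₃, h₄⟩ := h₂.node_of_height_eq (by rw [eA, hA'.height_eq])
        obtain ⟨h₄, h₅⟩ := h₄.node_of_height_eq (by rw [eB, hB'.height_eq])
        exact ⟨A', B', C', .inr rfl, ⟨hA', h₃⟩, ⟨hB', h₄⟩, ⟨hC', h₅⟩⟩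
    · rintro ⟨a, rfl⟩
      obtain ⟨h₁, h₂⟩ := (hf' _).2 ⟨fun i => a (.inl (.inl (.inl i))), rfl⟩
      obtain ⟨h₃, h₄⟩ := (hg' _).2 ⟨fun i => a (.inl (.inl (.inr i))), rfl⟩
      obtain ⟨h₅, h₆⟩ := (he' _).2 ⟨fun i => a (.inl (.inr i)), rfl⟩
      simp only [hF]
      split_ifs
      · refine ⟨.rot h h' h'' h₁ h₃ h₅, .node ?_ ?_ h₂ (.node ?_ ?_ h₄ h₆)⟩ <;>
          simp only [BinaryTree.height, ef, eg, ee] <;> omega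
      · refine ⟨.node ?_ ?_ (.node ?_ ?_ h₁ h₃) h₅, .rot ?_ ?_ ?_ h₂ h₄ h₆⟩ <;>
          (try simp only [BinaryTree.height, ef, eg, ee]) <;> omega

theorem IsBalancedInterval.isHypercubeInterval {I : BinaryTree Unit × BinaryTree Unit} {k : ℕ}
    (h : IsBalancedInterval I.1 I.2 k) : IsHypercubeInterval I k := by
  classical
  obtain ⟨ι, _, f, hk, hf, hf'⟩ := h.exists_hypercube
  have h₀ := h.isBalancedTree_left
  have h₁ := h.isBalancedTree_right
  have hinj : Function.Injective f := fun a b hab => by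
    have ha : BalancedLE (f a) (f a) := (hf a a).2 le_rfl
    exact le_antisymm ((hf a b).1 (hab ▸ ha)) ((hf b a).1 (hab ▸ ha))
  have hmem : ∀ T, (TamariLE I.1 T ∧ TamariLE T I.2) ↔ ∃ a, f a = T := by
    intro T
    rw [← hf']
    constructor
    · rintro ⟨h, h'⟩
      have hb := isBalancedTree_of_tamariLE h₀ h₁ h h'
      exact ⟨exists_isBalancedInterval_iff.2 ⟨h₀, hb, h⟩,
        exists_isBalancedInterval_iff.2 ⟨hb, h₁, h'⟩⟩
    · rintro ⟨h, h'⟩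
      exact ⟨h.choose_spec.tamariLE, h'.choose_spec.tamariLE⟩
  have hbal : ∀ a, IsBalancedTree (f a) := fun a =>
    ((hf' _).2 ⟨a, rfl⟩).1.choose_spec.isBalancedTree_right
  have hle : ∀ a b, TamariLE (f a) (f b) ↔ a ≤ b := by
    intro a b
    rw [← hf]
    exact ⟨fun h => exists_isBalancedInterval_iff.2 ⟨hbal a, hbal b, h⟩,
      fun h => h.choose_spec.tamariLE⟩
  let g : Finset (Fin k) → ι → Prop := fun s i => Fintype.equivFinOfCardEq hk i ∈ s
  have hg : ∀ s t, g s ≤ g t ↔ s ⊆ t := by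
    intro s t
    constructor
    · intro h j hj
      simpa [g] using h ((Fintype.equivFinOfCardEq hk).symm j) (by simpa [g] using hj)
    · exact fun h i hi => h hi
  have hgs : Function.Surjective g := by
    intro a
    refine ⟨Finset.univ.filter fun j => a ((Fintype.equivFinOfCardEq hk).symm j), ?_⟩
    funext i
    simp [g]
  have hgi : Function.Injective g := fun s t hst =>
    Finset.Subset.antisymm ((hg s t).1 hst.le) ((hg t s).1 hst.ge)
  let e : Finset (Fin k) ≃ TamariInterval I :=
    Equiv.ofBijective (fun s => ⟨f (g s), (hmem _).2 ⟨_, rfl⟩⟩)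
      ⟨fun s t hst => hgi (hinj (congrArg Subtype.val hst)), fun ⟨T, hT⟩ => by
        obtain ⟨a, rfl⟩ := (hmem T).1 hT
        obtain ⟨s, rfl⟩ := hgs a
        exact ⟨s, rfl⟩⟩
  have he : ∀ s t, TamariLE (e s).1 (e t).1 ↔ s ⊆ t := fun s t =>
    (hle (g s) (g t)).trans (hg s t)
  exact ⟨RelIso.symm ⟨e, fun {s t} => he s t⟩⟩

/-- Compare the cardinalities 2^j and 2^k. -/
theorem isHypercubeInterval_unique {I : BinaryTree Unit × BinaryTree Unit} {j k : ℕ}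
    (hj : IsHypercubeInterval I j) (hk : IsHypercubeInterval I k) : j = k := by
  obtain ⟨e⟩ := hj
  obtain ⟨e'⟩ := hk
  have := Fintype.card_congr (e.toEquiv.symm.trans e'.toEquiv)
  simpa using this

theorem isHypercubeInterval_iff {I : BinaryTree Unit × BinaryTree Unit} {k : ℕ}
    (hI : IsMaximalBalancedInterval I) :
    IsHypercubeInterval I k ↔ IsBalancedInterval I.1 I.2 k := by
  obtain ⟨j, hj⟩ := exists_isBalancedInterval_iff.2 ⟨hI.2.1.1, hI.2.2.1, hI.1⟩
  refine ⟨fun h => ?_, fun h => h.isHypercubeInterval⟩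
  rwa [isHypercubeInterval_unique h hj.isHypercubeInterval]

theorem existsUnique_isHypercubeInterval {I : BinaryTree Unit × BinaryTree Unit}
    (hI : IsMaximalBalancedInterval I) : ∃! k : ℕ, IsHypercubeInterval I k := by
  obtain ⟨j, hj⟩ := exists_isBalancedInterval_iff.2 ⟨hI.2.1.1, hI.2.2.1, hI.1⟩
  exact ⟨j, hj.isHypercubeInterval,
    fun k hk => isHypercubeInterval_unique hk hj.isHypercubeInterval⟩

/-! ### Minimal and maximal balanced trees -/

/-- The root exists and has imbalance `-1`. -/
def NegImbalance : BinaryTree Unit → Prop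
  | .nil => False
  | .node _ L R => L.height = R.height + 1

/-- The root exists and has imbalance `1`. -/
def PosImbalance : BinaryTree Unit → Prop
  | .nil => False
  | .node _ L R => R.height = L.height + 1

theorem isMinimalBalanced_nil : IsMinimalBalanced .nil :=
  ⟨trivial, fun _ h => nomatch h⟩

theorem isMaximalBalanced_nil : IsMaximalBalanced .nil :=
  ⟨trivial, fun _ h => nomatch h⟩

/-- This makes minimality and maximality local: a balanced rotation in a subtree does not affect the
imbalances above it. -/
theorem height_eq_of_rotation {T T' : BinaryTree Unit} (h : IsBalancedTree T)
    (h' : IsBalancedTree T') (hr : TreeRotation T T') : T'.height = T.height :=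
  (IsBalancedInterval.tail (.refl h) hr h').height_eq

/-- At the root, L∧(B∧C) comes from (L∧B)∧C, which is balanced exactly when h(B∧C) = h(L) + 1 and
h(B) ≤ h(C). -/
theorem isMinimalBalanced_node {L R : BinaryTree Unit} :
    IsMinimalBalanced (.node () L R) ↔
      L.height ≤ R.height + 1 ∧ R.height ≤ L.height + 1 ∧ IsMinimalBalanced L ∧
        IsMinimalBalanced R ∧ (R.height = L.height + 1 → NegImbalance R) := by
  constructor
  · rintro ⟨hb, hm⟩
    obtain ⟨⟨h₁, h₂⟩, hL, hR⟩ := isBalancedTree_node.1 hb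
    refine ⟨h₁, h₂, ⟨hL, fun T hT hT' => hm _ (.left _ hT) ?_⟩,
      ⟨hR, fun T hT hT' => hm _ (.right _ hT) ?_⟩, fun h => ?_⟩
    · have := height_eq_of_rotation hT' hL hT
      exact isBalancedTree_node.2 ⟨by omega, hT', hR⟩
    · have := height_eq_of_rotation hT' hR hT
      exact isBalancedTree_node.2 ⟨by omega, hL, hT'⟩
    · rcases R with _ | ⟨⟨⟩, B, C⟩
      · simp [BinaryTree.height] at h
      · by_contra hn
        refine hm _ (.root _ _ _) ?_
        simp only [NegImbalance, isBalancedTree_node, BinaryTree.height] at *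
        exact ⟨by omega, ⟨by omega, hL, hR.2.1⟩, hR.2.2⟩
  · rintro ⟨h₁, h₂, hL, hR, hn⟩
    refine ⟨isBalancedTree_node.2 ⟨⟨h₁, h₂⟩, hL.1, hR.1⟩, fun T hT hb => ?_⟩
    cases hT with
    | root A B C =>
      simp only [NegImbalance, isBalancedTree_node, BinaryTree.height] at *
      omega
    | left _ hr => exact hL.2 _ hr (isBalancedTree_node.1 hb).2.1
    | right _ hr => exact hR.2 _ hr (isBalancedTree_node.1 hb).2.2

/-- At the root, (A∧B)∧R becomes A∧(B∧R), which is balanced exactly when h(A∧B) = h(R) + 1 and h(B)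
≤ h(A). -/
theorem isMaximalBalanced_node {L R : BinaryTree Unit} :
    IsMaximalBalanced (.node () L R) ↔
      L.height ≤ R.height + 1 ∧ R.height ≤ L.height + 1 ∧ IsMaximalBalanced L ∧
        IsMaximalBalanced R ∧ (L.height = R.height + 1 → PosImbalance L) := by
  constructor
  · rintro ⟨hb, hm⟩
    obtain ⟨⟨h₁, h₂⟩, hL, hR⟩ := isBalancedTree_node.1 hb
    refine ⟨h₁, h₂, ⟨hL, fun T hT hT' => hm _ (.left _ hT) ?_⟩,
      ⟨hR, fun T hT hT' => hm _ (.right _ hT) ?_⟩, fun h => ?_⟩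
    · have := height_eq_of_rotation hL hT' hT
      exact isBalancedTree_node.2 ⟨by omega, hT', hR⟩
    · have := height_eq_of_rotation hR hT' hT
      exact isBalancedTree_node.2 ⟨by omega, hL, hT'⟩
    · rcases L with _ | ⟨⟨⟩, A, B⟩
      · simp [BinaryTree.height] at h
      · by_contra hn
        refine hm _ (.root _ _ _) ?_
        simp only [PosImbalance, isBalancedTree_node, BinaryTree.height] at *
        exact ⟨by omega, hL.2.1, by omega, hL.2.2, hR⟩
  · rintro ⟨h₁, h₂, hL, hR, hn⟩
    refine ⟨isBalancedTree_node.2 ⟨⟨h₁, h₂⟩, hL.1, hR.1⟩, fun T hT hb => ?_⟩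
    cases hT with
    | root A B C =>
      simp only [PosImbalance, isBalancedTree_node, BinaryTree.height] at *
      omega
    | left _ hr => exact hL.2 _ hr (isBalancedTree_node.1 hb).2.1
    | right _ hr => exact hR.2 _ hr (isBalancedTree_node.1 hb).2.2

/-! ### The functional equation as a contraction -/

section FunctionalEquation

open MvPowerSeries

variable {R : Type} [CommRing R]

/-- If `a` raises the weights by at least `e`, so does the substitution of `a` in a series without
constant term. -/
theorem add_le_weightedOrder_subst {σ τ : Type} {v : σ → ℕ} {w : τ → ℕ}
    {a : σ → MvPowerSeries τ R} (ha : HasSubst a) {e : ℕ}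
    (he : ∀ i, ((v i + e : ℕ) : ℕ∞) ≤ (a i).weightedOrder w) {f : MvPowerSeries σ R}
    (hf : constantCoeff f = 0) {n : ℕ} (hn : (n : ℕ∞) ≤ f.weightedOrder v) :
    ((n + e : ℕ) : ℕ∞) ≤ (subst a f).weightedOrder w := by
  refine le_trans ?_ (le_weightedOrder_subst w ha f)
  refine le_iInf₂ fun d hd => ?_
  have hd0 : d ≠ 0 := by
    rintro rfl
    exact hd (by simpa using hf)
  obtain ⟨i, hi⟩ := Finsupp.ne_iff.1 hd0
  have h₁ : n ≤ Finsupp.weight v d := by exact_mod_cast hn.trans (weightedOrder_le _ hd)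
  -- Every variable occurring in the monomial gains `e`; without constant term at least one occurs.
  have h₂ : n + e ≤ ∑ j ∈ d.support, d j * (v j + e) := by
    simp only [Finsupp.weight_apply, Finsupp.sum, smul_eq_mul] at h₁
    simp only [mul_add, Finset.sum_add_distrib]
    refine add_le_add h₁ ?_
    have hmem : i ∈ d.support := Finsupp.mem_support_iff.2 hi
    refine le_trans ?_
      (Finset.single_le_sum (f := fun j => d j * e) (fun _ _ => Nat.zero_le _) hmem)
    exact Nat.le_mul_of_pos_left _ (Nat.pos_of_ne_zero hi)
  refine le_trans (Nat.cast_le.2 h₂) ?_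
  rw [Finsupp.weight_apply, Finsupp.sum, Nat.cast_sum]
  refine Finset.sum_le_sum fun j _ => ?_
  rw [Nat.cast_mul, nsmul_eq_mul]
  gcongr
  exact he j

/-- Weights for which the substitution `mbiSubs` strictly increases the order. -/
def mbiWeight : Fin 4 → ℕ := ![2, 1, 2, 2]

theorem le_weightedOrder_X {σ : Type} (w : σ → ℕ) (i : σ) :
    (w i : ℕ∞) ≤ (X i : MvPowerSeries σ R).weightedOrder w := by
  classical
  refine nat_le_weightedOrder w fun d hd => ?_
  rw [coeff_X, if_neg]
  rintro rfl
  simp [Finsupp.weight_single] at hd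

theorem le_weightedOrder_add {σ : Type} {w : σ → ℕ} {n : ℕ∞} {f g : MvPowerSeries σ R}
    (hf : n ≤ f.weightedOrder w) (hg : n ≤ g.weightedOrder w) : n ≤ (f + g).weightedOrder w :=
  (le_min hf hg).trans (min_weightedOrder_le_add w)

theorem le_weightedOrder_mul_of_le {σ : Type} {w : σ → ℕ} {m n k : ℕ} {f g : MvPowerSeries σ R}
    (hf : (m : ℕ∞) ≤ f.weightedOrder w) (hg : (n : ℕ∞) ≤ g.weightedOrder w) (h : k ≤ m + n) :
    (k : ℕ∞) ≤ (f * g).weightedOrder w :=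
  (Nat.cast_le.2 h).trans <| by
    rw [Nat.cast_add]
    exact (add_le_add hf hg).trans (le_weightedOrder_mul w)

/-- Since y ↦ x, the weight of x must exceed that of y. With weights 2, 1, 2, 2 the monomials xy,
yz, yt weigh 3 and x² weighs 4, against 2 for x, z and t. -/
theorem mbiWeight_lt_weightedOrder (ξ : R) (i : Fin 4) :
    ((mbiWeight i + 1 : ℕ) : ℕ∞) ≤ (mbiSubs ξ i).weightedOrder mbiWeight := by
  have hx := le_weightedOrder_X (R := R) mbiWeight 0
  have hy := le_weightedOrder_X (R := R) mbiWeight 1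
  have hz := le_weightedOrder_X (R := R) mbiWeight 2
  have ht := le_weightedOrder_X (R := R) mbiWeight 3
  have hC : ((0 : ℕ) : ℕ∞) ≤ (C ξ : MvPowerSeries (Fin 4) R).weightedOrder mbiWeight := by simp
  have h2 : ((0 : ℕ) : ℕ∞) ≤ (2 : MvPowerSeries (Fin 4) R).weightedOrder mbiWeight := by simp
  have hyz := le_weightedOrder_mul_of_le (le_weightedOrder_mul_of_le hy hz le_rfl) hC
    (k := 3) (by simp [mbiWeight])
  fin_cases i
  · refine le_weightedOrder_add (le_weightedOrder_add ?_ ?_) hyz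
    · rw [pow_two]
      exact le_weightedOrder_mul_of_le hx hx (by simp [mbiWeight])
    · exact le_weightedOrder_mul_of_le (le_weightedOrder_mul_of_le h2 hy le_rfl) ht
        (by simp [mbiWeight])
  · exact hx
  · refine le_weightedOrder_add ?_ (le_weightedOrder_mul_of_le hx hy (by simp [mbiWeight]))
    rw [pow_two]
    exact le_weightedOrder_mul_of_le hx hx (by simp [mbiWeight])
  · exact le_weightedOrder_add (le_weightedOrder_mul_of_le hy ht (by simp [mbiWeight])) hyz

theorem constantCoeff_mbiSubs (ξ : R) (i : Fin 4) : constantCoeff (mbiSubs ξ i) = 0 := by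
  fin_cases i <;> simp [mbiSubs]

theorem succ_le_weightedOrder_subst_mbiSubs (ξ : R) {f : MvPowerSeries (Fin 4) R}
    (hf : constantCoeff f = 0) {n : ℕ} (hn : (n : ℕ∞) ≤ f.weightedOrder mbiWeight) :
    ((n + 1 : ℕ) : ℕ∞) ≤ (subst (mbiSubs ξ) f).weightedOrder mbiWeight :=
  add_le_weightedOrder_subst (hasSubst_mbiSubs ξ) (mbiWeight_lt_weightedOrder ξ) hf hn

theorem constantCoeff_subst_mbiSubs (ξ : R) {f : MvPowerSeries (Fin 4) R}
    (hf : constantCoeff f = 0) : constantCoeff (subst (mbiSubs ξ) f) = 0 :=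
  constantCoeff_subst_eq_zero (hasSubst_mbiSubs ξ) (constantCoeff_mbiSubs ξ) hf

theorem eq_zero_of_forall_le_weightedOrder {σ : Type} {w : σ → ℕ} {f : MvPowerSeries σ R}
    (h : ∀ n : ℕ, (n : ℕ∞) ≤ f.weightedOrder w) : f = 0 := by
  rw [← weightedOrder_eq_top_iff w]
  exact ENat.eq_top_iff_forall_ge.2 h

/-- The difference of two solutions is fixed by the substitution, which raises its order, so it has
infinite order. -/
theorem isMbiSolution_unique {ξ : R} {S S' : MvPowerSeries (Fin 4) R} (h : IsMbiSolution ξ S)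
    (h' : IsMbiSolution ξ S') : S = S' := by
  have hc : constantCoeff (S - S') = 0 := by rw [map_sub, h.1, h'.1, sub_zero]
  have hs : S - S' = subst (mbiSubs ξ) (S - S') := by
    rw [subst_sub (hasSubst_mbiSubs ξ)]
    nth_rewrite 1 [h.2, h'.2]
    ring
  refine sub_eq_zero.1 (eq_zero_of_forall_le_weightedOrder (w := mbiWeight) fun n => ?_)
  induction n with
  | zero => simp
  | succ n ih =>
    rw [hs]
    exact succ_le_weightedOrder_subst_mbiSubs ξ hc ih

/-- The successive approximations of the solution of the functional equation. -/
noncomputable def mbiApprox (ξ : R) : ℕ → MvPowerSeries (Fin 4) R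
  | 0 => 0
  | n + 1 => X 0 + subst (mbiSubs ξ) (mbiApprox ξ n)

theorem constantCoeff_mbiApprox (ξ : R) (n : ℕ) : constantCoeff (mbiApprox ξ n) = 0 := by
  induction n with
  | zero => simp [mbiApprox]
  | succ n ih => simp [mbiApprox, constantCoeff_subst_mbiSubs ξ ih]

theorem le_weightedOrder_mbiApprox_sub (ξ : R) (n : ℕ) :
    ((n + 1 : ℕ) : ℕ∞) ≤ (mbiApprox ξ (n + 1) - mbiApprox ξ n).weightedOrder mbiWeight := by
  induction n with
  | zero =>
    have : subst (mbiSubs ξ) (0 : MvPowerSeries (Fin 4) R) = 0 := by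
      rw [← substAlgHom_apply (hasSubst_mbiSubs ξ), map_zero]
    simp only [mbiApprox, this, add_zero, sub_zero]
    exact (Nat.cast_le.2 (by simp [mbiWeight])).trans (le_weightedOrder_X mbiWeight 0)
  | succ n ih =>
    have : mbiApprox ξ (n + 1 + 1) - mbiApprox ξ (n + 1) =
        subst (mbiSubs ξ) (mbiApprox ξ (n + 1) - mbiApprox ξ n) := by
      rw [subst_sub (hasSubst_mbiSubs ξ)]
      exact add_sub_add_left_eq_sub _ _ _
    rw [this]
    exact succ_le_weightedOrder_subst_mbiSubs ξ
      (by simp [constantCoeff_mbiApprox]) ih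

/-- All corrections after stage `n` have order at least n + 1; this justifies the definition of
`mbiSeries`. -/
theorem coeff_mbiApprox_add (ξ : R) {d : Fin 4 →₀ ℕ} {n : ℕ} (hd : Finsupp.weight mbiWeight d ≤ n)
    (m : ℕ) : coeff d (mbiApprox ξ (n + m)) = coeff d (mbiApprox ξ n) := by
  induction m with
  | zero => rfl
  | succ m ih =>
    rw [← ih, ← sub_eq_zero, ← map_sub]
    refine coeff_eq_zero_of_lt_weightedOrder mbiWeight
      (lt_of_lt_of_le ?_ (le_weightedOrder_mbiApprox_sub ξ (n + m)))
    exact_mod_cast by omega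

/-- The solution of the functional equation. -/
noncomputable def mbiSeries (ξ : R) : MvPowerSeries (Fin 4) R :=
  fun d => coeff d (mbiApprox ξ (Finsupp.weight mbiWeight d))

theorem le_weightedOrder_mbiSeries_sub (ξ : R) (n : ℕ) :
    ((n + 1 : ℕ) : ℕ∞) ≤ (mbiSeries ξ - mbiApprox ξ n).weightedOrder mbiWeight := by
  refine nat_le_weightedOrder _ fun d hd => ?_
  obtain ⟨m, rfl⟩ := Nat.exists_eq_add_of_le (Nat.lt_succ_iff.1 hd)
  rw [map_sub, coeff_mbiApprox_add ξ le_rfl]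
  exact sub_self _

theorem isMbiSolution_mbiSeries (ξ : R) : IsMbiSolution ξ (mbiSeries ξ) := by
  have hc : constantCoeff (mbiSeries ξ) = 0 := by
    rw [← coeff_zero_eq_constantCoeff_apply]
    exact constantCoeff_mbiApprox ξ _
  refine ⟨hc, sub_eq_zero.1 (eq_zero_of_forall_le_weightedOrder (w := mbiWeight) fun n => ?_)⟩
  have h : mbiSeries ξ - (X 0 + subst (mbiSubs ξ) (mbiSeries ξ)) =
      (mbiSeries ξ - mbiApprox ξ (n + 1)) +
        -subst (mbiSubs ξ) (mbiSeries ξ - mbiApprox ξ n) := by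
    rw [subst_sub (hasSubst_mbiSubs ξ), mbiApprox]
    ring
  rw [h]
  refine le_weightedOrder_add ((Nat.cast_le.2 (by omega)).trans
    (le_weightedOrder_mbiSeries_sub ξ (n + 1))) ?_
  rw [weightedOrder_neg]
  exact (Nat.cast_le.2 (by omega)).trans (succ_le_weightedOrder_subst_mbiSubs ξ
    (by simp [hc, constantCoeff_mbiApprox]) (le_weightedOrder_mbiSeries_sub ξ n))

theorem existsUnique_isMbiSolution (ξ : R) : ∃! S, IsMbiSolution ξ S :=
  ⟨mbiSeries ξ, isMbiSolution_mbiSeries ξ, fun _ h =>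
    isMbiSolution_unique h (isMbiSolution_mbiSeries ξ)⟩

/-! ### Iterating the equation along an orbit -/

/-- The orbit of the point `(x, 0, 0, 0)` under the substitution `mbiSubs`. -/
noncomputable def mbiOrbit (ξ : R) : ℕ → Fin 4 → MvPowerSeries Unit R
  | 0 => mbiPoint R
  | n + 1 => ![mbiOrbit ξ n 0 ^ 2 + 2 * mbiOrbit ξ n 1 * mbiOrbit ξ n 3 +
        mbiOrbit ξ n 1 * mbiOrbit ξ n 2 * C ξ,
      mbiOrbit ξ n 0,
      mbiOrbit ξ n 0 ^ 2 + mbiOrbit ξ n 0 * mbiOrbit ξ n 1,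
      mbiOrbit ξ n 1 * mbiOrbit ξ n 3 + mbiOrbit ξ n 1 * mbiOrbit ξ n 2 * C ξ]

theorem constantCoeff_mbiOrbit (ξ : R) (n : ℕ) (i : Fin 4) :
    constantCoeff (mbiOrbit ξ n i) = 0 := by
  induction n generalizing i with
  | zero => fin_cases i <;> simp [mbiOrbit, mbiPoint, PowerSeries.X]
  | succ n ih => fin_cases i <;> simp [mbiOrbit, ih]

theorem hasSubst_mbiOrbit (ξ : R) (n : ℕ) : HasSubst (mbiOrbit ξ n) :=
  hasSubst_of_constantCoeff_zero (constantCoeff_mbiOrbit ξ n)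

theorem mbiOrbit_succ (ξ : R) (n : ℕ) (i : Fin 4) :
    mbiOrbit ξ (n + 1) i = subst (mbiOrbit ξ n) (mbiSubs ξ i) := by
  rw [← substAlgHom_apply (hasSubst_mbiOrbit ξ n)]
  have hX := substAlgHom_X (R := R) (hasSubst_mbiOrbit ξ n)
  have hC : substAlgHom (hasSubst_mbiOrbit ξ n) (C ξ) = C ξ :=
    (substAlgHom (hasSubst_mbiOrbit ξ n)).commutes ξ
  fin_cases i <;> simp [mbiOrbit, mbiSubs, -substAlgHom_apply, -coe_substAlgHom, hX, hC, map_ofNat]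

/-- The single variable gets weight 2 to match the weight of x at the starting point; each step of
the orbit then gains 1. -/
theorem le_weightedOrder_mbiOrbit (ξ : R) (n : ℕ) (i : Fin 4) :
    ((mbiWeight i + n : ℕ) : ℕ∞) ≤ (mbiOrbit ξ n i).weightedOrder fun _ => 2 := by
  induction n generalizing i with
  | zero =>
    fin_cases i
    · exact le_weightedOrder_X (fun _ => 2) ()
    all_goals simp [mbiOrbit, mbiPoint]
  | succ n ih =>
    rw [mbiOrbit_succ]
    have := add_le_weightedOrder_subst (hasSubst_mbiOrbit ξ n) ih (constantCoeff_mbiSubs ξ i)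
      (mbiWeight_lt_weightedOrder ξ i)
    rwa [show mbiWeight i + (n + 1) = mbiWeight i + 1 + n by omega]

/-- At each point p of the orbit the equation reads S(p) = p₀ + S(p'), with p' the next point. -/
theorem mbiSpecialize_eq {ξ : R} {S : MvPowerSeries (Fin 4) R}
    (hS : IsMbiSolution ξ S) (n : ℕ) :
    mbiSpecialize S = ∑ h ∈ Finset.range n, mbiOrbit ξ h 0 + subst (mbiOrbit ξ n) S := by
  induction n with
  | zero => simp [mbiSpecialize, mbiOrbit]
  | succ n ih =>
    rw [ih, Finset.sum_range_succ, add_assoc]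
    congr 1
    nth_rewrite 1 [hS.2]
    rw [subst_add (hasSubst_mbiOrbit ξ n), subst_X (hasSubst_mbiOrbit ξ n),
      subst_comp_subst_apply (hasSubst_mbiSubs ξ) (hasSubst_mbiOrbit ξ n)]
    simp only [← mbiOrbit_succ]

/-- The coefficients of `S(x, 0, 0, 0)` are sums of coefficients along the orbit. -/
theorem coeff_mbiSpecialize {ξ : R} {S : MvPowerSeries (Fin 4) R}
    (hS : IsMbiSolution ξ S) (n : ℕ) :
    PowerSeries.coeff n (mbiSpecialize S) =
      ∑ h ∈ Finset.range (2 * n), PowerSeries.coeff (R := R) n (mbiOrbit ξ h 0) := by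
  rw [mbiSpecialize_eq hS (2 * n), map_add, map_sum]
  refine add_eq_left.2 ?_
  have h₁ : ((1 : ℕ) : ℕ∞) ≤ S.weightedOrder mbiWeight := by
    refine nat_le_weightedOrder _ fun d hd => ?_
    have hd0 : d = 0 := by
      by_contra hd0
      obtain ⟨i, hi⟩ := Finsupp.ne_iff.1 hd0
      have h := Finsupp.le_weight mbiWeight (s := i) (by fin_cases i <;> simp [mbiWeight]) d
      simp only [Finsupp.coe_zero, Pi.zero_apply] at hi
      omega
    rw [hd0]
    exact hS.1
  -- After 2n steps the remainder has order at least 2n + 1, whereas the monomial of degree n weighs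
  -- 2n.
  have h := add_le_weightedOrder_subst (hasSubst_mbiOrbit ξ (2 * n))
    (le_weightedOrder_mbiOrbit ξ (2 * n)) hS.1 h₁
  refine coeff_eq_zero_of_lt_weightedOrder (fun _ => 2) (lt_of_lt_of_le ?_ h)
  rw [Finsupp.weight_single]
  exact_mod_cast by simp only [smul_eq_mul]; omega

end FunctionalEquation

/-! ### Decomposition of maximal intervals at the root -/

theorem isMaximalBalancedInterval_iff {I : BinaryTree Unit × BinaryTree Unit} :
    IsMaximalBalancedInterval I ↔
      BalancedLE I.1 I.2 ∧ IsMinimalBalanced I.1 ∧ IsMaximalBalanced I.2 := by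
  rw [BalancedLE, exists_isBalancedInterval_iff, IsMaximalBalancedInterval]
  exact ⟨fun h => ⟨⟨h.2.1.1, h.2.2.1, h.1⟩, h.2⟩, fun h => ⟨h.1.2.2, h.2⟩⟩

/-- The interval whose trees have a left subtree in one interval and a right subtree in another. -/
def nodePair (p : (BinaryTree Unit × BinaryTree Unit) × (BinaryTree Unit × BinaryTree Unit)) :
    BinaryTree Unit × BinaryTree Unit :=
  (.node () p.1.1 p.2.1, .node () p.1.2 p.2.2)

/-- The interval whose end points differ by a rotation at the root, and whose other parameters are
three intervals. -/
def rotPair (p : ((BinaryTree Unit × BinaryTree Unit) × (BinaryTree Unit × BinaryTree Unit)) ×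
      (BinaryTree Unit × BinaryTree Unit)) : BinaryTree Unit × BinaryTree Unit :=
  (.node () (.node () p.1.1.1 p.1.2.1) p.2.1, .node () p.1.1.2 (.node () p.1.2.2 p.2.2))

theorem nodePair_injective : Function.Injective nodePair := by
  rintro ⟨⟨_, _⟩, ⟨_, _⟩⟩ ⟨⟨_, _⟩, ⟨_, _⟩⟩ h
  simp only [nodePair, Prod.mk.injEq, BinaryTree.node.injEq, true_and] at h
  simp [h]

theorem rotPair_injective : Function.Injective rotPair := by
  rintro ⟨⟨⟨_, _⟩, ⟨_, _⟩⟩, ⟨_, _⟩⟩ ⟨⟨⟨_, _⟩, ⟨_, _⟩⟩, ⟨_, _⟩⟩ h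
  simp only [rotPair, Prod.mk.injEq, BinaryTree.node.injEq, true_and] at h
  simp [h]

theorem height_snd_eq {I : BinaryTree Unit × BinaryTree Unit} (hI : IsMaximalBalancedInterval I) :
    I.2.height = I.1.height :=
  (isMaximalBalancedInterval_iff.1 hI).1.height_eq

theorem isMaximalBalancedInterval_nodePair {I J : BinaryTree Unit × BinaryTree Unit}
    (hI : IsMaximalBalancedInterval I) (hJ : IsMaximalBalancedInterval J)
    (h : I.1.height ≤ J.1.height + 1) (h' : J.1.height ≤ I.1.height + 1)
    (hn : J.1.height = I.1.height + 1 → NegImbalance J.1)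
    (hp : I.1.height = J.1.height + 1 → PosImbalance I.2) :
    IsMaximalBalancedInterval (nodePair (I, J)) := by
  have eI := height_snd_eq hI
  have eJ := height_snd_eq hJ
  rw [isMaximalBalancedInterval_iff] at *
  refine ⟨.node h h' hI.1 hJ.1, isMinimalBalanced_node.2 ⟨h, h', hI.2.1, hJ.2.1, hn⟩,
    isMaximalBalanced_node.2 ?_⟩
  rw [eI, eJ]
  exact ⟨h, h', hI.2.2, hJ.2.2, hp⟩

/-- No imbalance condition is needed: the two top nodes have imbalance at most 0 in the lower tree
and at least 0 in the upper one, so the conditions of minimality and maximality there are vacuous.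
-/
theorem isMaximalBalancedInterval_rotPair {I J K : BinaryTree Unit × BinaryTree Unit}
    (hI : IsMaximalBalancedInterval I) (hJ : IsMaximalBalancedInterval J)
    (hK : IsMaximalBalancedInterval K) (h : I.1.height = K.1.height)
    (h' : J.1.height ≤ I.1.height) (h'' : I.1.height ≤ J.1.height + 1) :
    IsMaximalBalancedInterval (rotPair ((I, J), K)) := by
  have eI := height_snd_eq hI
  have eJ := height_snd_eq hJ
  have eK := height_snd_eq hK
  rw [isMaximalBalancedInterval_iff] at *
  refine ⟨.rot h h' h'' hI.1 hJ.1 hK.1, ?_, ?_⟩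
  · simp only [rotPair, isMinimalBalanced_node, BinaryTree.height]
    exact ⟨by omega, by omega, ⟨by omega, by omega, hI.2.1, hJ.2.1, by omega⟩, hK.2.1, by omega⟩
  · simp only [rotPair, isMaximalBalanced_node, BinaryTree.height]
    exact ⟨by omega, by omega, hI.2.2, ⟨by omega, by omega, hJ.2.2, hK.2.2, by omega⟩, by omega⟩

theorem isMaximalBalancedInterval_cases {K : BinaryTree Unit × BinaryTree Unit}
    (hK : IsMaximalBalancedInterval K) :
    K = (.nil, .nil) ∨
    (∃ I J, K = nodePair (I, J) ∧ IsMaximalBalancedInterval I ∧ IsMaximalBalancedInterval J ∧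
      I.1.height ≤ J.1.height + 1 ∧ J.1.height ≤ I.1.height + 1 ∧
      (J.1.height = I.1.height + 1 → NegImbalance J.1) ∧
      (I.1.height = J.1.height + 1 → PosImbalance I.2)) ∨
    ∃ A B C, K = rotPair ((A, B), C) ∧ IsMaximalBalancedInterval A ∧
      IsMaximalBalancedInterval B ∧ IsMaximalBalancedInterval C ∧ A.1.height = C.1.height ∧
      B.1.height ≤ A.1.height ∧ A.1.height ≤ B.1.height + 1 := by
  obtain ⟨T₀, T₁⟩ := K
  obtain ⟨⟨k, h⟩, h₀, h₁⟩ := isMaximalBalancedInterval_iff.1 hK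
  cases h with
  | nil => exact .inl rfl
  | @node L₀ L₁ R₀ R₁ _ _ h h' hL hR =>
    obtain ⟨-, -, hL₀, hR₀, hn⟩ := isMinimalBalanced_node.1 h₀
    obtain ⟨-, -, hL₁, hR₁, hp⟩ := isMaximalBalanced_node.1 h₁
    rw [hL.height_eq, hR.height_eq] at hp
    exact .inr (.inl ⟨(L₀, L₁), (R₀, R₁), rfl,
      isMaximalBalancedInterval_iff.2 ⟨⟨_, hL⟩, hL₀, hL₁⟩,
      isMaximalBalancedInterval_iff.2 ⟨⟨_, hR⟩, hR₀, hR₁⟩, h, h', hn, hp⟩)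
  | @rot A₀ A₁ B₀ B₁ C₀ C₁ _ _ _ h h' h'' hA hB hC =>
    obtain ⟨-, -, h₀, hC₀, -⟩ := isMinimalBalanced_node.1 h₀
    obtain ⟨-, -, hA₀, hB₀, -⟩ := isMinimalBalanced_node.1 h₀
    obtain ⟨-, -, hA₁, h₁, -⟩ := isMaximalBalanced_node.1 h₁
    obtain ⟨-, -, hB₁, hC₁, -⟩ := isMaximalBalanced_node.1 h₁
    exact .inr (.inr ⟨(A₀, A₁), (B₀, B₁), (C₀, C₁), rfl,
      isMaximalBalancedInterval_iff.2 ⟨⟨_, hA⟩, hA₀, hA₁⟩,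
      isMaximalBalancedInterval_iff.2 ⟨⟨_, hB⟩, hB₀, hB₁⟩,
      isMaximalBalancedInterval_iff.2 ⟨⟨_, hC⟩, hC₀, hC₁⟩, h, h', h''⟩)

/-- The left subtrees of the two ends have equal heights on one side and different heights on the
other. -/
theorem nodePair_ne_rotPair {I J A B C : BinaryTree Unit × BinaryTree Unit}
    (hI : IsMaximalBalancedInterval I) (hA : IsMaximalBalancedInterval A) :
    nodePair (I, J) ≠ rotPair ((A, B), C) := by
  intro h
  have eI := height_snd_eq hI
  have eA := height_snd_eq hA
  simp only [nodePair, rotPair, Prod.mk.injEq, BinaryTree.node.injEq, true_and] at h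
  rw [h.1.1, h.2.1] at eI
  simp only [BinaryTree.height] at eI
  omega

theorem finite_setOf_height_le (h : ℕ) : {T : BinaryTree Unit | T.height ≤ h}.Finite := by
  induction h with
  | zero =>
    refine (Set.finite_singleton .nil).subset fun T hT => ?_
    cases T with
    | nil => rfl
    | node _ _ _ => simp [BinaryTree.height] at hT
  | succ h ih =>
    refine ((Set.finite_singleton .nil).union
      (ih.image2 (fun L R => BinaryTree.node () L R) ih)).subset fun T hT => ?_
    cases T with
    | nil => exact .inl rfl
    | node _ L R =>
      simp only [BinaryTree.height, Set.mem_ofPred_eq] at hT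
      exact .inr ⟨L, by simp only [Set.mem_ofPred_eq]; omega, R,
        by simp only [Set.mem_ofPred_eq]; omega, rfl⟩

theorem finite_maximal_height (h : ℕ) :
    {I | IsMaximalBalancedInterval I ∧ I.1.height = h}.Finite := by
  refine ((finite_setOf_height_le h).prod (finite_setOf_height_le h)).subset ?_
  rintro I ⟨hI, rfl⟩
  exact ⟨le_refl I.1.height, (height_snd_eq hI).le⟩

/-! ### Maximal intervals by height -/

/-- The maximal balanced intervals of height `h`. -/
noncomputable def maximalOfHeight (h : ℕ) : Finset (BinaryTree Unit × BinaryTree Unit) :=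
  (finite_maximal_height h).toFinset

/-- The maximal balanced intervals of height `h - 1`. -/
noncomputable def maximalOfHeightPred : ℕ → Finset (BinaryTree Unit × BinaryTree Unit)
  | 0 => ∅
  | h + 1 => maximalOfHeight h

open Classical in
/-- The maximal balanced intervals of height `h` whose lower bound has imbalance `-1`. -/
noncomputable def maximalNeg (h : ℕ) : Finset (BinaryTree Unit × BinaryTree Unit) :=
  (maximalOfHeight h).filter fun I => NegImbalance I.1

open Classical in
/-- The maximal balanced intervals of height `h` whose upper bound has imbalance `1`. -/
noncomputable def maximalPos (h : ℕ) : Finset (BinaryTree Unit × BinaryTree Unit) :=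
  (maximalOfHeight h).filter fun I => PosImbalance I.2

open Classical in
/-- The pairs of maximal balanced intervals, the first of height `h - 1` and the second of height
`h - 1` or `h - 2`. -/
noncomputable def maximalPairs :
    ℕ → Finset ((BinaryTree Unit × BinaryTree Unit) × (BinaryTree Unit × BinaryTree Unit))
  | 0 => ∅
  | h + 1 => maximalOfHeight h ×ˢ maximalOfHeight h ∪ maximalOfHeight h ×ˢ maximalOfHeightPred h

section Membership

variable {h : ℕ} {I J : BinaryTree Unit × BinaryTree Unit}

theorem mem_maximalOfHeight :
    I ∈ maximalOfHeight h ↔ IsMaximalBalancedInterval I ∧ I.1.height = h := by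
  simp [maximalOfHeight]

theorem mem_maximalOfHeightPred :
    I ∈ maximalOfHeightPred h ↔ IsMaximalBalancedInterval I ∧ I.1.height + 1 = h := by
  cases h with
  | zero => simp [maximalOfHeightPred]
  | succ h => simp [maximalOfHeightPred, mem_maximalOfHeight]

theorem mem_maximalNeg : I ∈ maximalNeg h ↔
    (IsMaximalBalancedInterval I ∧ I.1.height = h) ∧ NegImbalance I.1 := by
  simp [maximalNeg, mem_maximalOfHeight]

theorem mem_maximalPos : I ∈ maximalPos h ↔
    (IsMaximalBalancedInterval I ∧ I.1.height = h) ∧ PosImbalance I.2 := by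
  simp [maximalPos, mem_maximalOfHeight]

theorem mem_maximalPairs : (I, J) ∈ maximalPairs h ↔
    IsMaximalBalancedInterval I ∧ IsMaximalBalancedInterval J ∧ I.1.height + 1 = h ∧
      J.1.height ≤ I.1.height ∧ I.1.height ≤ J.1.height + 1 := by
  cases h with
  | zero => simp [maximalPairs]
  | succ h =>
    simp only [maximalPairs, Finset.mem_union, Finset.mem_product, mem_maximalOfHeight,
      mem_maximalOfHeightPred]
    constructor
    · rintro (⟨⟨hI, e⟩, hJ, e'⟩ | ⟨⟨hI, e⟩, hJ, e'⟩)
      · exact ⟨hI, hJ, by omega, by omega, by omega⟩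
      · exact ⟨hI, hJ, by omega, by omega, by omega⟩
    · rintro ⟨hI, hJ, e, e₁, e₂⟩
      by_cases e₃ : J.1.height = h
      · exact .inl ⟨⟨hI, by omega⟩, hJ, e₃⟩
      · exact .inr ⟨⟨hI, by omega⟩, hJ, by omega⟩

end Membership

open Classical in
theorem mem_image_nodePair {s t : Finset (BinaryTree Unit × BinaryTree Unit)}
    {K : BinaryTree Unit × BinaryTree Unit} :
    K ∈ (s ×ˢ t).image nodePair ↔ ∃ I ∈ s, ∃ J ∈ t, K = nodePair (I, J) := by
  simp only [Finset.mem_image, Finset.mem_product]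
  constructor
  · rintro ⟨⟨I, J⟩, ⟨hI, hJ⟩, rfl⟩
    exact ⟨I, hI, J, hJ, rfl⟩
  · rintro ⟨I, hI, J, hJ, rfl⟩
    exact ⟨(I, J), ⟨hI, hJ⟩, rfl⟩

open Classical in
theorem mem_image_rotPair
    {p : Finset ((BinaryTree Unit × BinaryTree Unit) × (BinaryTree Unit × BinaryTree Unit))}
    {t : Finset (BinaryTree Unit × BinaryTree Unit)} {K : BinaryTree Unit × BinaryTree Unit} :
    K ∈ (p ×ˢ t).image rotPair ↔ ∃ A B C, (A, B) ∈ p ∧ C ∈ t ∧ K = rotPair ((A, B), C) := by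
  simp only [Finset.mem_image, Finset.mem_product]
  constructor
  · rintro ⟨⟨⟨A, B⟩, C⟩, ⟨hp, hC⟩, rfl⟩
    exact ⟨A, B, C, hp, hC, rfl⟩
  · rintro ⟨A, B, C, hp, hC, rfl⟩
    exact ⟨((A, B), C), ⟨hp, hC⟩, rfl⟩

theorem height_nodePair (I J : BinaryTree Unit × BinaryTree Unit) :
    (nodePair (I, J)).1.height = max I.1.height J.1.height + 1 := rfl

theorem height_rotPair (A B C : BinaryTree Unit × BinaryTree Unit) :
    (rotPair ((A, B), C)).1.height = max (max A.1.height B.1.height + 1) C.1.height + 1 := rfl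

-- The four pieces become the terms x², yt, yt and yzξ of the substitution.
open Classical in
theorem maximalOfHeight_succ (h : ℕ) : maximalOfHeight (h + 1) =
    (((maximalOfHeight h ×ˢ maximalOfHeight h).image nodePair ∪
      (maximalOfHeightPred h ×ˢ maximalNeg h).image nodePair) ∪
      (maximalPos h ×ˢ maximalOfHeightPred h).image nodePair) ∪
      (maximalPairs h ×ˢ maximalOfHeightPred h).image rotPair := by
  ext K
  simp only [Finset.mem_union, mem_image_nodePair, mem_image_rotPair, mem_maximalOfHeight,
    mem_maximalOfHeightPred, mem_maximalNeg, mem_maximalPos, mem_maximalPairs]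
  constructor
  · rintro ⟨hK, e⟩
    rcases isMaximalBalancedInterval_cases hK with
      rfl | ⟨I, J, rfl, hI, hJ, h₁, h₂, hn, hp⟩ | ⟨A, B, C, rfl, hA, hB, hC, h₁, h₂, h₃⟩
    · simp [BinaryTree.height] at e
    · rw [height_nodePair] at e
      left
      rcases lt_trichotomy I.1.height J.1.height with hlt | heq | hgt
      · exact .inl (.inr ⟨I, ⟨hI, by omega⟩, J, ⟨⟨hJ, by omega⟩, hn (by omega)⟩, rfl⟩)
      · exact .inl (.inl ⟨I, ⟨hI, by omega⟩, J, ⟨hJ, by omega⟩, rfl⟩)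
      · exact .inr ⟨I, ⟨⟨hI, by omega⟩, hp (by omega)⟩, J, ⟨hJ, by omega⟩, rfl⟩
    · rw [height_rotPair] at e
      exact .inr ⟨A, B, C, ⟨hA, hB, by omega, h₂, h₃⟩, ⟨hC, by omega⟩, rfl⟩
  · rintro (((⟨I, ⟨hI, e⟩, J, ⟨hJ, e'⟩, rfl⟩ | ⟨I, ⟨hI, e⟩, J, ⟨⟨hJ, e'⟩, hn⟩, rfl⟩) |
      ⟨I, ⟨⟨hI, e⟩, hp⟩, J, ⟨hJ, e'⟩, rfl⟩) | ⟨A, B, C, ⟨hA, hB, e, h₂, h₃⟩, ⟨hC, e'⟩, rfl⟩)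
    · exact ⟨isMaximalBalancedInterval_nodePair hI hJ (by omega) (by omega) (by omega)
        (by omega), by rw [height_nodePair]; omega⟩
    · exact ⟨isMaximalBalancedInterval_nodePair hI hJ (by omega) (by omega) (fun _ => hn)
        (by omega), by rw [height_nodePair]; omega⟩
    · exact ⟨isMaximalBalancedInterval_nodePair hI hJ (by omega) (by omega) (by omega)
        (fun _ => hp), by rw [height_nodePair]; omega⟩
    · exact ⟨isMaximalBalancedInterval_rotPair hA hB hC (by omega) h₂ h₃,
        by rw [height_rotPair]; omega⟩

-- Intervals with a root rotation have imbalance -1 at the root of the lower end and 1 at that of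
-- the upper end, so they occur both here and in `maximalPos_succ`.
open Classical in
theorem maximalNeg_succ (h : ℕ) : maximalNeg (h + 1) =
    (maximalPos h ×ˢ maximalOfHeightPred h).image nodePair ∪
      (maximalPairs h ×ˢ maximalOfHeightPred h).image rotPair := by
  ext K
  rw [maximalNeg, Finset.mem_filter, maximalOfHeight_succ]
  simp only [Finset.mem_union, mem_image_nodePair, mem_image_rotPair, mem_maximalOfHeight,
    mem_maximalOfHeightPred, mem_maximalNeg, mem_maximalPos, mem_maximalPairs]
  constructor
  · rintro ⟨((⟨I, ⟨hI, e⟩, J, ⟨hJ, e'⟩, rfl⟩ | ⟨I, ⟨hI, e⟩, J, ⟨⟨hJ, e'⟩, -⟩, rfl⟩) | hK) | hK, hn⟩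
    · simp only [nodePair, NegImbalance] at hn
      omega
    · simp only [nodePair, NegImbalance] at hn
      omega
    · exact .inl hK
    · exact .inr hK
  · rintro (hK | hK)
    · refine ⟨.inl (.inr hK), ?_⟩
      obtain ⟨I, ⟨⟨hI, e⟩, -⟩, J, ⟨hJ, e'⟩, rfl⟩ := hK
      simp only [nodePair, NegImbalance]
      omega
    · refine ⟨.inr hK, ?_⟩
      obtain ⟨A, B, C, ⟨-, -, e, h₂, h₃⟩, ⟨-, e'⟩, rfl⟩ := hK
      simp only [rotPair, NegImbalance, BinaryTree.height]
      omega

open Classical in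
theorem maximalPos_succ (h : ℕ) : maximalPos (h + 1) =
    (maximalOfHeightPred h ×ˢ maximalNeg h).image nodePair ∪
      (maximalPairs h ×ˢ maximalOfHeightPred h).image rotPair := by
  ext K
  rw [maximalPos, Finset.mem_filter, maximalOfHeight_succ]
  simp only [Finset.mem_union, mem_image_nodePair, mem_image_rotPair, mem_maximalOfHeight,
    mem_maximalOfHeightPred, mem_maximalNeg, mem_maximalPos, mem_maximalPairs]
  constructor
  · rintro ⟨((⟨I, ⟨hI, e⟩, J, ⟨hJ, e'⟩, rfl⟩ | hK) | ⟨I, ⟨⟨hI, e⟩, -⟩, J, ⟨hJ, e'⟩, rfl⟩) | hK, hp⟩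
    · simp only [nodePair, PosImbalance, height_snd_eq hI, height_snd_eq hJ] at hp
      omega
    · exact .inl hK
    · simp only [nodePair, PosImbalance, height_snd_eq hI, height_snd_eq hJ] at hp
      omega
    · exact .inr hK
  · rintro (hK | hK)
    · refine ⟨.inl (.inl (.inr hK)), ?_⟩
      obtain ⟨I, ⟨hI, e⟩, J, ⟨⟨hJ, e'⟩, -⟩, rfl⟩ := hK
      simp only [nodePair, PosImbalance, height_snd_eq hI, height_snd_eq hJ]
      omega
    · refine ⟨.inr hK, ?_⟩
      obtain ⟨A, B, C, ⟨hA, hB, e, h₂, h₃⟩, ⟨hC, e'⟩, rfl⟩ := hK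
      simp only [rotPair, PosImbalance, BinaryTree.height, height_snd_eq hA, height_snd_eq hB,
        height_snd_eq hC]
      omega

open Classical in
theorem disjoint_nodePair {s s' t t' : Finset (BinaryTree Unit × BinaryTree Unit)}
    (h : Disjoint s s' ∨ Disjoint t t') :
    Disjoint ((s ×ˢ t).image nodePair) ((s' ×ˢ t').image nodePair) :=
  (Finset.disjoint_image nodePair_injective).2 (Finset.disjoint_product.2 h)

open Classical in
theorem disjoint_nodePair_rotPair (s t : Finset (BinaryTree Unit × BinaryTree Unit))
    (hs : ∀ I ∈ s, IsMaximalBalancedInterval I) (h : ℕ) :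
    Disjoint ((s ×ˢ t).image nodePair)
      ((maximalPairs h ×ˢ maximalOfHeightPred h).image rotPair) := by
  refine Finset.disjoint_left.2 fun K hK hK' => ?_
  obtain ⟨I, hI, J, hJ, rfl⟩ := mem_image_nodePair.1 hK
  obtain ⟨A, B, C, hA, -, e⟩ := mem_image_rotPair.1 hK'
  exact nodePair_ne_rotPair (hs I hI) (mem_maximalPairs.1 hA).1 e

/-! ### Dimension and generating series -/

open Classical in
/-- The dimension of a balanced interval. -/
noncomputable def intervalDim (I : BinaryTree Unit × BinaryTree Unit) : ℕ :=
  if h : ∃ k, IsBalancedInterval I.1 I.2 k then h.choose else 0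

/-- The number of rotations depends only on the end points, being the dimension of a hypercube. -/
theorem intervalDim_eq {I : BinaryTree Unit × BinaryTree Unit} {k : ℕ}
    (h : IsBalancedInterval I.1 I.2 k) : intervalDim I = k := by
  have h' : ∃ k, IsBalancedInterval I.1 I.2 k := ⟨k, h⟩
  rw [intervalDim, dif_pos h']
  exact isHypercubeInterval_unique h'.choose_spec.isHypercubeInterval h.isHypercubeInterval

theorem isHypercubeInterval_iff_intervalDim {I : BinaryTree Unit × BinaryTree Unit} {k : ℕ}
    (hI : IsMaximalBalancedInterval I) : IsHypercubeInterval I k ↔ intervalDim I = k := by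
  rw [isHypercubeInterval_iff hI]
  refine ⟨intervalDim_eq, ?_⟩
  rintro rfl
  obtain ⟨k, hk⟩ := (isMaximalBalancedInterval_iff.1 hI).1
  rwa [intervalDim_eq hk]

section GeneratingSeries

open MvPowerSeries

variable {R : Type} [CommRing R]

/-- The monomial recording the number of leaves and the dimension of a balanced interval. -/
noncomputable def intervalWeight (ξ : R) (I : BinaryTree Unit × BinaryTree Unit) :
    MvPowerSeries Unit R :=
  C ξ ^ intervalDim I * X () ^ I.1.numLeaves

theorem intervalWeight_nodePair (ξ : R) {I J : BinaryTree Unit × BinaryTree Unit}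
    (hI : IsMaximalBalancedInterval I) (hJ : IsMaximalBalancedInterval J)
    (h : I.1.height ≤ J.1.height + 1) (h' : J.1.height ≤ I.1.height + 1) :
    intervalWeight ξ (nodePair (I, J)) = intervalWeight ξ I * intervalWeight ξ J := by
  obtain ⟨a, hI⟩ := (isMaximalBalancedInterval_iff.1 hI).1
  obtain ⟨b, hJ⟩ := (isMaximalBalancedInterval_iff.1 hJ).1
  have := intervalDim_eq (I := nodePair (I, J)) (.node h h' hI hJ)
  rw [intervalWeight, this]
  simp only [intervalWeight, intervalDim_eq hI, intervalDim_eq hJ, nodePair,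
    BinaryTree.numLeaves]
  ring

theorem intervalWeight_rotPair (ξ : R) {A B K : BinaryTree Unit × BinaryTree Unit}
    (hA : IsMaximalBalancedInterval A) (hB : IsMaximalBalancedInterval B)
    (hK : IsMaximalBalancedInterval K) (h : A.1.height = K.1.height)
    (h' : B.1.height ≤ A.1.height) (h'' : A.1.height ≤ B.1.height + 1) :
    intervalWeight ξ (rotPair ((A, B), K)) =
      intervalWeight ξ A * intervalWeight ξ B * intervalWeight ξ K * C ξ := by
  obtain ⟨a, hA⟩ := (isMaximalBalancedInterval_iff.1 hA).1
  obtain ⟨b, hB⟩ := (isMaximalBalancedInterval_iff.1 hB).1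
  obtain ⟨c, hK⟩ := (isMaximalBalancedInterval_iff.1 hK).1
  have := intervalDim_eq (I := rotPair ((A, B), K)) (.rot h h' h'' hA hB hK)
  rw [intervalWeight, this]
  simp only [intervalWeight, intervalDim_eq hA, intervalDim_eq hB, intervalDim_eq hK,
    rotPair, BinaryTree.numLeaves]
  ring

/-- The generating series of a finite set of balanced intervals. -/
noncomputable def intervalSum (ξ : R) (s : Finset (BinaryTree Unit × BinaryTree Unit)) :
    MvPowerSeries Unit R :=
  ∑ I ∈ s, intervalWeight ξ I

/-- The generating series of a finite set of pairs of balanced intervals. -/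
noncomputable def intervalPairSum (ξ : R)
    (p : Finset ((BinaryTree Unit × BinaryTree Unit) × (BinaryTree Unit × BinaryTree Unit))) :
    MvPowerSeries Unit R :=
  ∑ q ∈ p, intervalWeight ξ q.1 * intervalWeight ξ q.2

theorem intervalPairSum_product (ξ : R) (s t : Finset (BinaryTree Unit × BinaryTree Unit)) :
    intervalPairSum ξ (s ×ˢ t) = intervalSum ξ s * intervalSum ξ t := by
  rw [intervalPairSum, intervalSum, intervalSum, Finset.sum_mul_sum, Finset.sum_product]

open Classical in
theorem intervalSum_image_nodePair (ξ : R) {s t : Finset (BinaryTree Unit × BinaryTree Unit)}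
    (hs : ∀ I ∈ s, IsMaximalBalancedInterval I) (ht : ∀ I ∈ t, IsMaximalBalancedInterval I)
    (h : ∀ I ∈ s, ∀ J ∈ t, I.1.height ≤ J.1.height + 1 ∧ J.1.height ≤ I.1.height + 1) :
    intervalSum ξ ((s ×ˢ t).image nodePair) = intervalSum ξ s * intervalSum ξ t := by
  rw [← intervalPairSum_product, intervalSum, intervalPairSum,
    Finset.sum_image nodePair_injective.injOn]
  refine Finset.sum_congr rfl fun q hq => ?_
  obtain ⟨h₁, h₂⟩ := Finset.mem_product.1 hq
  exact intervalWeight_nodePair ξ (hs _ h₁) (ht _ h₂) (h _ h₁ _ h₂).1 (h _ h₁ _ h₂).2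

open Classical in
theorem intervalSum_image_rotPair (ξ : R) (h : ℕ) :
    intervalSum ξ ((maximalPairs h ×ˢ maximalOfHeightPred h).image rotPair) =
      intervalSum ξ (maximalOfHeightPred h) * intervalPairSum ξ (maximalPairs h) * C ξ := by
  rw [mul_comm (intervalSum _ _), intervalSum, intervalPairSum, intervalSum,
    Finset.sum_image rotPair_injective.injOn, Finset.sum_mul_sum, Finset.sum_product,
    Finset.sum_mul]
  refine Finset.sum_congr rfl fun q hq => ?_
  rw [Finset.sum_mul]
  refine Finset.sum_congr rfl fun K hK => ?_
  obtain ⟨hA, hB, e, h₁, h₂⟩ := mem_maximalPairs.1 hq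
  obtain ⟨hK, e'⟩ := mem_maximalOfHeightPred.1 hK
  exact intervalWeight_rotPair ξ hA hB hK (by omega) h₁ h₂

theorem intervalSum_union (ξ : R) [DecidableEq (BinaryTree Unit × BinaryTree Unit)]
    {s t : Finset (BinaryTree Unit × BinaryTree Unit)}
    (h : Disjoint s t) : intervalSum ξ (s ∪ t) = intervalSum ξ s + intervalSum ξ t :=
  Finset.sum_union h

theorem disjoint_maximalOfHeight_pred (h : ℕ) :
    Disjoint (maximalOfHeight h) (maximalOfHeightPred h) := by
  refine Finset.disjoint_left.2 fun I hI hI' => ?_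
  rw [mem_maximalOfHeight] at hI
  rw [mem_maximalOfHeightPred] at hI'
  omega

theorem maximalNeg_subset (h : ℕ) : maximalNeg h ⊆ maximalOfHeight h :=
  fun _ hI => mem_maximalOfHeight.2 (mem_maximalNeg.1 hI).1

theorem intervalSum_maximalPairs_succ (ξ : R) (h : ℕ) :
    intervalPairSum ξ (maximalPairs (h + 1)) = intervalSum ξ (maximalOfHeight h) ^ 2 +
      intervalSum ξ (maximalOfHeight h) * intervalSum ξ (maximalOfHeightPred h) := by
  rw [maximalPairs, intervalPairSum, Finset.sum_union, ← intervalPairSum, ← intervalPairSum,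
    intervalPairSum_product, intervalPairSum_product, pow_two]
  exact Finset.disjoint_product.2 (.inr (disjoint_maximalOfHeight_pred h))

open Classical in
theorem intervalSum_pred_neg (ξ : R) (h : ℕ) :
    intervalSum ξ ((maximalOfHeightPred h ×ˢ maximalNeg h).image nodePair) =
      intervalSum ξ (maximalOfHeightPred h) * intervalSum ξ (maximalNeg h) := by
  refine intervalSum_image_nodePair ξ (fun I hI => (mem_maximalOfHeightPred.1 hI).1)
    (fun I hI => (mem_maximalNeg.1 hI).1.1) fun I hI J hJ => ?_
  have := (mem_maximalOfHeightPred.1 hI).2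
  have := (mem_maximalNeg.1 hJ).1.2
  omega

open Classical in
theorem intervalSum_pos_pred (ξ : R) (h : ℕ) :
    intervalSum ξ ((maximalPos h ×ˢ maximalOfHeightPred h).image nodePair) =
      intervalSum ξ (maximalOfHeightPred h) * intervalSum ξ (maximalPos h) := by
  rw [mul_comm]
  refine intervalSum_image_nodePair ξ (fun I hI => (mem_maximalPos.1 hI).1.1)
    (fun I hI => (mem_maximalOfHeightPred.1 hI).1) fun I hI J hJ => ?_
  have := (mem_maximalPos.1 hI).1.2
  have := (mem_maximalOfHeightPred.1 hJ).2
  omega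

theorem intervalSum_maximalNeg_succ (ξ : R) (h : ℕ) :
    intervalSum ξ (maximalNeg (h + 1)) =
      intervalSum ξ (maximalOfHeightPred h) * intervalSum ξ (maximalPos h) +
        intervalSum ξ (maximalOfHeightPred h) * intervalPairSum ξ (maximalPairs h) * C ξ := by
  classical
  rw [maximalNeg_succ, intervalSum_union, intervalSum_pos_pred, intervalSum_image_rotPair]
  exact disjoint_nodePair_rotPair _ _ (fun I hI => (mem_maximalPos.1 hI).1.1) h

theorem intervalSum_maximalPos_succ (ξ : R) (h : ℕ) :
    intervalSum ξ (maximalPos (h + 1)) =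
      intervalSum ξ (maximalOfHeightPred h) * intervalSum ξ (maximalNeg h) +
        intervalSum ξ (maximalOfHeightPred h) * intervalPairSum ξ (maximalPairs h) * C ξ := by
  classical
  rw [maximalPos_succ, intervalSum_union, intervalSum_pred_neg, intervalSum_image_rotPair]
  exact disjoint_nodePair_rotPair _ _ (fun I hI => (mem_maximalOfHeightPred.1 hI).1) h

theorem maximalOfHeight_zero : maximalOfHeight 0 = {(.nil, .nil)} := by
  ext K
  rw [mem_maximalOfHeight, Finset.mem_singleton]
  constructor
  · rintro ⟨hK, e⟩
    rcases isMaximalBalancedInterval_cases hK with h | ⟨I, J, rfl, -⟩ | ⟨A, B, C, rfl, -⟩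
    · exact h
    · simp [height_nodePair] at e
    · simp [height_rotPair] at e
  · rintro rfl
    exact ⟨⟨.refl, isMinimalBalanced_nil, isMaximalBalanced_nil⟩, rfl⟩

theorem maximalNeg_zero : maximalNeg 0 = ∅ := by
  ext K
  simp only [maximalNeg, maximalOfHeight_zero, Finset.mem_filter, Finset.mem_singleton,
    Finset.notMem_empty, iff_false]
  rintro ⟨rfl, h⟩
  exact h

theorem maximalPos_zero : maximalPos 0 = ∅ := by
  ext K
  simp only [maximalPos, maximalOfHeight_zero, Finset.mem_filter, Finset.mem_singleton,
    Finset.notMem_empty, iff_false]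
  rintro ⟨rfl, h⟩
  exact h

/-- The recursions of the two series are exchanged by swapping them. This is why t serves for both
and where the coefficient 2 of yt comes from. -/
theorem intervalSum_maximalPos (ξ : R) (h : ℕ) :
    intervalSum ξ (maximalPos h) = intervalSum ξ (maximalNeg h) := by
  induction h with
  | zero => rw [maximalPos_zero, maximalNeg_zero]
  | succ h ih => rw [intervalSum_maximalPos_succ, intervalSum_maximalNeg_succ, ih]

theorem intervalSum_maximalOfHeight_succ (ξ : R) (h : ℕ) :
    intervalSum ξ (maximalOfHeight (h + 1)) = intervalSum ξ (maximalOfHeight h) ^ 2 +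
      2 * intervalSum ξ (maximalOfHeightPred h) * intervalSum ξ (maximalNeg h) +
        intervalSum ξ (maximalOfHeightPred h) * intervalPairSum ξ (maximalPairs h) * C ξ := by
  classical
  have hF : ∀ I ∈ maximalOfHeight h, IsMaximalBalancedInterval I :=
    fun I hI => (mem_maximalOfHeight.1 hI).1
  have hY : ∀ I ∈ maximalOfHeightPred h, IsMaximalBalancedInterval I :=
    fun I hI => (mem_maximalOfHeightPred.1 hI).1
  have hU : ∀ I ∈ maximalPos h, IsMaximalBalancedInterval I :=
    fun I hI => (mem_maximalPos.1 hI).1.1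
  have hd := disjoint_maximalOfHeight_pred h
  rw [maximalOfHeight_succ, intervalSum_union, intervalSum_union, intervalSum_union,
    intervalSum_pred_neg, intervalSum_pos_pred, intervalSum_image_rotPair,
    intervalSum_maximalPos, intervalSum_image_nodePair ξ hF hF]
  · ring
  · intro I hI J hJ
    have := (mem_maximalOfHeight.1 hI).2
    have := (mem_maximalOfHeight.1 hJ).2
    omega
  -- The pieces without root rotation are separated by the heights of the two subtrees: (h, h),
  -- (h-1, h), (h, h-1).
  · exact disjoint_nodePair (.inl hd)
  · exact Finset.disjoint_union_left.2 ⟨disjoint_nodePair (.inr hd),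
      disjoint_nodePair (.inr (hd.symm.mono_right (maximalNeg_subset h)).symm)⟩
  · exact Finset.disjoint_union_left.2 ⟨Finset.disjoint_union_left.2
      ⟨disjoint_nodePair_rotPair _ _ hF h, disjoint_nodePair_rotPair _ _ hY h⟩,
      disjoint_nodePair_rotPair _ _ hU h⟩

/-- The orbit of `(x, 0, 0, 0)` consists of generating series of maximal balanced intervals. -/
theorem mbiOrbit_eq (ξ : R) (h : ℕ) :
    mbiOrbit ξ h = ![intervalSum ξ (maximalOfHeight h), intervalSum ξ (maximalOfHeightPred h),
      intervalPairSum ξ (maximalPairs h), intervalSum ξ (maximalNeg h)] := by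
  induction h with
  | zero =>
    have h₀ : intervalDim (.nil, .nil) = 0 := intervalDim_eq .nil
    simp only [mbiOrbit, mbiPoint, maximalOfHeight_zero, maximalOfHeightPred, maximalPairs,
      maximalNeg_zero, intervalSum, intervalPairSum, Finset.sum_empty, Finset.sum_singleton,
      intervalWeight, h₀, BinaryTree.numLeaves, pow_zero, pow_one, one_mul]
    rfl
  | succ h ih =>
    rw [intervalSum_maximalOfHeight_succ, intervalSum_maximalPairs_succ,
      intervalSum_maximalNeg_succ, intervalSum_maximalPos, mbiOrbit, ih]
    rfl

theorem coeff_intervalWeight (ξ : R) (n : ℕ) (I : BinaryTree Unit × BinaryTree Unit) :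
    PowerSeries.coeff (R := R) n (intervalWeight ξ I) =
      if I.1.numLeaves = n then ξ ^ intervalDim I else 0 := by
  have : intervalWeight ξ I =
      (PowerSeries.C (ξ ^ intervalDim I) * PowerSeries.X ^ I.1.numLeaves : PowerSeries R) := by
    rw [map_pow]
    rfl
  rw [this, PowerSeries.coeff_C_mul, PowerSeries.coeff_X_pow]
  simp [eq_comm]

theorem mem_maximalBalancedIntervals {n : ℕ} {I : BinaryTree Unit × BinaryTree Unit} :
    I ∈ maximalBalancedIntervals n ↔ IsMaximalBalancedInterval I ∧ I.1.numLeaves = n := by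
  refine ⟨fun h => ⟨h.1, h.2.1⟩, fun h => ⟨h.1, h.2, ?_⟩⟩
  rw [(isMaximalBalancedInterval_iff.1 h.1).1.choose_spec.numLeaves_eq, h.2]

open Classical in
/-- The coefficients of `S(x, 0, 0, 0)` enumerate maximal balanced intervals by dimension. -/
theorem coeff_mbiSpecialize_eq_sum {ξ : R} {S : MvPowerSeries (Fin 4) R}
    (hS : IsMbiSolution ξ S) (n : ℕ) :
    PowerSeries.coeff n (mbiSpecialize S) =
      ∑ I ∈ (finite_maximalBalancedIntervals n).toFinset, ξ ^ intervalDim I := by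
  rw [coeff_mbiSpecialize hS]
  -- Group the intervals by height. All heights fall in the range, since the height of a tree is
  -- less than its number of leaves.
  refine Eq.trans ?_ (Finset.sum_fiberwise_of_maps_to (t := Finset.range (2 * n))
    (g := fun I : BinaryTree Unit × BinaryTree Unit => I.1.height) ?_ _)
  · refine Finset.sum_congr rfl fun h _ => ?_
    rw [mbiOrbit_eq]
    simp only [Matrix.cons_val_zero, intervalSum]
    rw [map_sum]
    simp only [coeff_intervalWeight]
    rw [← Finset.sum_filter]
    refine Finset.sum_congr ?_ fun _ _ => rfl
    ext I
    simp only [Finset.mem_filter, mem_maximalOfHeight, Set.Finite.mem_toFinset,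
      mem_maximalBalancedIntervals]
    tauto
  · intro I hI
    rw [Set.Finite.mem_toFinset, mem_maximalBalancedIntervals] at hI
    have h₁ := I.1.height_le_numNodes
    have h₂ := I.1.numLeaves_eq_numNodes_succ
    rw [Finset.mem_range]
    omega

end GeneratingSeries

end BalancedTamari

/-! ### The two enumerations -/

theorem mainTheorem6 :
    -- the functional equation without `ξ` defines `S_mbi`, and `S_mbi(x, 0, 0, 0)` enumerates
    -- the maximal balanced binary tree intervals by number of leaves
    (∃! S : MvPowerSeries (Fin 4) ℤ, IsMbiSolution (1 : ℤ) S) ∧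
    (∀ S : MvPowerSeries (Fin 4) ℤ, IsMbiSolution (1 : ℤ) S →
      mbiSpecialize S = maximalBalancedIntervalSeries) ∧
    -- each of these intervals is a hypercube of a well-defined dimension
    (∀ I : BinaryTree Unit × BinaryTree Unit, IsMaximalBalancedInterval I →
      ∃! k : ℕ, IsHypercubeInterval I k) ∧
    -- the refinement, with coefficients in `ℤ[ξ]`: the parameter `ξ` records the dimension
    (∃! S : MvPowerSeries (Fin 4) (Polynomial ℤ),
      IsMbiSolution (Polynomial.X : Polynomial ℤ) S) ∧
    (∀ S : MvPowerSeries (Fin 4) (Polynomial ℤ),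
      IsMbiSolution (Polynomial.X : Polynomial ℤ) S →
      ∀ n k : ℕ, (PowerSeries.coeff n (mbiSpecialize S)).coeff k =
        ({I ∈ maximalBalancedIntervals n | IsHypercubeInterval I k}.ncard : ℤ)) := by
  classical
  refine ⟨BalancedTamari.existsUnique_isMbiSolution 1, fun S hS => ?_,
    fun I hI => BalancedTamari.existsUnique_isHypercubeInterval hI,
    BalancedTamari.existsUnique_isMbiSolution _, fun S hS n k => ?_⟩
  -- For ξ = 1 every interval contributes 1.
  · ext n
    rw [BalancedTamari.coeff_mbiSpecialize_eq_sum hS, maximalBalancedIntervalSeries,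
      PowerSeries.coeff_mk, Set.ncard_eq_toFinset_card _ (finite_maximalBalancedIntervals n)]
    simp
  -- For ξ the polynomial variable, the coefficient of ξ^k selects the intervals of dimension `k`.
  · rw [BalancedTamari.coeff_mbiSpecialize_eq_sum hS, Polynomial.finsetSum_coeff]
    simp only [Polynomial.coeff_X_pow]
    rw [Finset.sum_boole, ← Set.ncard_coe_finset]
    congr 2
    ext I
    simp only [Finset.coe_filter, Set.Finite.mem_toFinset, Set.mem_ofPred_eq]
    refine and_congr_right fun hI => ?_
    rw [BalancedTamari.isHypercubeInterval_iff_intervalDim hI.1, eq_comm]
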